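/- Let $e\in\mathbb R$, $c>0$, $\mu>0$, let $\phi\in C^\infty(\mathbb R\times\mathbb R^3;\mathbb R)$, $A\in C^\infty(\mathbb R\times\mathbb R^3;\mathbb R^3)$, $S_0\in C^\infty(\mathbb R^3;\mathbb R)$, $a_0\in C^\infty(\mathbb R^3;\mathbb C)$, and put $$H(x,p,t)=e\,\phi(t,x)+\frac1{2\mu}\Big|p-\frac ec A(t,x)\Big|^2 .$$ For $x_0\in\mathbb R^3$ let $(x(t,x_0),p(t,x_0))$ be the solution of $\dot x=H_p(x,p,t)$, $\dot p=-H_x(x,p,t)$, $x|_{t=0}=x_0$, $p|_{t=0}=\nabla S_0(x_0)$; it exists for $|t|<T(x_0)$. Let $$\mathcal T=\{(t,x(t,x_0)):\ x_0\in\operatorname{supp}a_0,\ |t|<T(x_0)\}$$ be the ray tube, where $\operatorname{supp}a_0$ is the closed support. Let $T>0$, and suppose that for all $|t|<T$ the solutions $(x(t,x_0),p(t,x_0))$ exist for every $x_0\in\mathbb R^3$ and the map $x_0\mapsto x(t,x_0)$ is a $C^\infty$-diffeomorphism of $\mathbb R^3$ onto $\mathbb R^3$. Then the Cauchy problem $$(i\hbar\partial_t-e\phi)\psi=\frac1{2\mu}\Big(-i\hbar\nabla-\frac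 ec A\Big)^2\psi,\qquad \psi|_{t=0}=a_0\,e^{iS_0/\hbar}$$ has a formal Debye expansion $\psi\sim\big(\sum_{k\ge0}\hbar^k a_k(t,x)\big)e^{iS(t,x)/\hbar}$, $\hbar\to0$, for $|t|<T$. That is, there are a real function $S$ and complex functions $a_k$ ($k\ge 0$), independent of $\hbar$ and $C^\infty$ on $\{|t|<T\}\times\mathbb R^3$, such that 1. $-\partial_tS=H(x,\nabla S,t)$ for $|t|<T$, and $S|_{t=0}=S_0$; 2. $a_0(0,x)=a_0(x)$, and $a_k(0,x)=0$ for $k\ge1$; 3. the series satisfies the Schrödinger equation formally to all orders in $\hbar$: for every $N\ge0$ and every compact $K\subset\{|t|<T\}\times\mathbb R^3$ there is a constant $C$ such that $\psi_N=\big(\sum_{k=0}^N\hbar^ka_k\big)e^{iS/\hbar}$ satisfies $$\Big|(i\hbar\partial_t-e\phi)\psi_N-\frac1{2\mu}\Big(-i\hbar\nabla-\frac ec A\Big)^2\psi_N\Big|\le C\,\hbar^{N+2}\quad\text{on }K,\ 0<\hbar\le1.$$ Moreover, these can be chosen so that the expansion is identically zero outside $\mathcal T$: $a_k(t,x)=0$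 whenever $|t|<T$, $(t,x)\notin\mathcal T$, $k=0,1,2,\dots$ -/

import Mathlib

open Set
open scoped ContDiff Manifold Gradient

noncomputable section

namespace WKB

/-- Physical space `ℝ³` with its Euclidean norm. -/
abbrev Space : Type := EuclideanSpace ℝ (Fin 3)

/-- Space-time `ℝ × ℝ³`; points are written `(t, x)`. -/
abbrev SpaceTime : Type := ℝ × Space

/-- The Hamiltonian `H(x,p,t) = e φ(t,x) + (1/(2μ)) |p - (e/c) A(t,x)|²` of a nonrelativistic
particle of charge `e` and mass `μ` in the Maxwell field with potentials `φ`, `A`. -/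
def hamiltonian (e c μ : ℝ) (φ : SpaceTime → ℝ) (A : SpaceTime → Space)
    (x p : Space) (t : ℝ) : ℝ :=
  e * φ (t, x) + 1 / (2 * μ) * ‖p - (e / c) • A (t, x)‖ ^ 2

/-- `(x, p)` solves, for `|t| < τ`, the Hamilton system `ẋ = H_p`, `ṗ = -H_x` with the initial
conditions `x(0) = x₀`, `p(0) = ∇S₀(x₀)`. -/
structure IsRay (e c μ : ℝ) (φ : SpaceTime → ℝ) (A : SpaceTime → Space) (S₀ : Space → ℝ)
    (x₀ : Space) (τ : ℝ) (x p : ℝ → Space) : Prop where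
  x_zero : x 0 = x₀
  p_zero : p 0 = ∇ S₀ x₀
  x_eq : ∀ t : ℝ, |t| < τ →
    HasDerivAt x (∇ (fun q : Space => hamiltonian e c μ φ A (x t) q t) (p t)) t
  p_eq : ∀ t : ℝ, |t| < τ →
    HasDerivAt p (-∇ (fun y : Space => hamiltonian e c μ φ A y (p t) t) (x t)) t

/-- The ray tube emanating from `a₀ e^{iS₀/h}`: all points `(t, x(t,x₀))` on rays that start at
a point `x₀` of the (closed) support of `a₀`, as long as the ray exists. -/
def rayTube (e c μ : ℝ) (φ : SpaceTime → ℝ) (A : SpaceTime → Space) (S₀ : Space → ℝ)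
    (a₀ : Space → ℂ) : Set SpaceTime :=
  {z | ∃ x₀ ∈ tsupport a₀, ∃ (τ : ℝ) (x p : ℝ → Space),
    IsRay e c μ φ A S₀ x₀ τ x p ∧ |z.1| < τ ∧ x z.1 = z.2}

/-- The time slab `{(t, x) : |t| < T}`. -/
def slab (T : ℝ) : Set SpaceTime := {z | |z.1| < T}

/-- The time derivative `∂_t ψ`. -/
def timeDeriv (ψ : SpaceTime → ℂ) (z : SpaceTime) : ℂ :=
  deriv (fun s : ℝ => ψ (s, z.2)) z.1

/-- The spatial partial derivative `∂_j ψ`. -/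
def spaceDeriv (j : Fin 3) (ψ : SpaceTime → ℂ) (z : SpaceTime) : ℂ :=
  fderiv ℝ (fun y : Space => ψ (z.1, y)) z.2 (EuclideanSpace.single j 1)

/-- The `j`-th component `-i h ∂_j - (e/c) A_j` of the kinetic momentum operator. -/
def momentum (e c h : ℝ) (A : SpaceTime → Space) (j : Fin 3) (ψ : SpaceTime → ℂ)
    (z : SpaceTime) : ℂ :=
  -Complex.I * h * spaceDeriv j ψ z - ((e / c * A z j : ℝ) : ℂ) * ψ z

/-- The Schrödinger operator
`ψ ↦ (i h ∂_t - e φ) ψ - (1/(2μ)) (-i h ∇ - (e/c) A)² ψ`;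
`ψ` solves the Schrödinger equation where this vanishes. -/
def schrodinger (e c μ h : ℝ) (φ : SpaceTime → ℝ) (A : SpaceTime → Space) (ψ : SpaceTime → ℂ)
    (z : SpaceTime) : ℂ :=
  Complex.I * h * timeDeriv ψ z - ((e * φ z : ℝ) : ℂ) * ψ z
    - ((1 / (2 * μ) : ℝ) : ℂ) * ∑ j : Fin 3, momentum e c h A j (momentum e c h A j ψ) z

/-- The partial sum `(∑_{k ≤ N} h^k a_k) e^{iS/h}`. -/
def debyeSum (S : SpaceTime → ℝ) (a : ℕ → SpaceTime → ℂ) (h : ℝ) (N : ℕ) (z : SpaceTime) : ℂ :=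
  (∑ k ∈ Finset.range (N + 1), (h : ℂ) ^ k * a k z) * Complex.exp (Complex.I * S z / h)

/-- `(∑_k h^k a_k) e^{iS/h}` is, for `|t| < T`, a formal Debye expansion of the solution of the
Cauchy problem for the Schrödinger equation with `ψ|_{t=0} = a₀ e^{iS₀/h}`.

The real phase `S` and the amplitudes `a_k` do not depend on `h`. The phase solves the
Hamilton-Jacobi equation; the initial conditions hold at each order in `h`; and the formal series
satisfies the Schrödinger equation to all orders in `h`. The last point is expressed by partial
sums: applying the Schrödinger operator to a single term `h^k a_k e^{iS/h}` gives `e^{iS/h}` times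
a combination of `h^k`, `h^(k+1)`, `h^(k+2)`, where the `h^k` coefficient vanishes by the
Hamilton-Jacobi equation; so the terms after the `N`-th contribute only from order `h^(N+2)` on, and
the formal equation holds iff, for every `N`, the `N`-th partial sum satisfies the equation up to
`O(h^(N+2))`. -/
structure IsDebyeExpansion (e c μ : ℝ) (φ : SpaceTime → ℝ) (A : SpaceTime → Space)
    (S₀ : Space → ℝ) (a₀ : Space → ℂ) (T : ℝ) (S : SpaceTime → ℝ) (a : ℕ → SpaceTime → ℂ) :
    Prop where
  phase_smooth : ContDiffOn ℝ ∞ S (slab T)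
  amplitude_smooth : ∀ k, ContDiffOn ℝ ∞ (a k) (slab T)
  hamilton_jacobi : ∀ z ∈ slab T,
    -deriv (fun s : ℝ => S (s, z.2)) z.1
      = hamiltonian e c μ φ A z.2 (∇ (fun y : Space => S (z.1, y)) z.2) z.1
  phase_initial : ∀ x, S (0, x) = S₀ x
  amplitude_initial_zero : ∀ x, a 0 (0, x) = a₀ x
  amplitude_initial_succ : ∀ k x, a (k + 1) (0, x) = 0
  formal_solution : ∀ (N : ℕ) (K : Set SpaceTime), IsCompact K → K ⊆ slab T →
    ∃ C : ℝ, ∀ h : ℝ, 0 < h → h ≤ 1 → ∀ z ∈ K,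
      ‖schrodinger e c μ h φ A (debyeSum S a h N) z‖ ≤ C * h ^ (N + 2)

end WKB

end

/-!
The phase is found by characteristics. Integrating the Lagrangian along the rays, starting from
`S₀`, gives a function `s(t, x₀)` whose differential is `⟪p, dx⟫ - H dt`; its pullback `S` by the
inverse of `x₀ ↦ x(t, x₀)` therefore satisfies `∇S = p` and `-∂_t S = H(x, ∇S, t)`. Conjugation by
`e^{iS/h}` turns the Schrödinger operator into `i h 𝓣 + h²/(2μ) Δ`, where the transport operator `𝓣`
is the derivative along the rays plus half the divergence of their velocity field. Hence `a₀` has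
to satisfy `𝓣 a₀ = 0` and `a_{k+1}` has to satisfy `𝓣 a_{k+1} = i/(2μ) Δ a_k`. These are linear
ordinary differential equations along the rays, solved by Duhamel's formula, so all `a_k` vanish on
rays that start off the support of the initial amplitude. In the partial sums everything cancels
but `h^(N+2)/(2μ) Δ a_N e^{iS/h}`.

That `x(t, x₀)` is jointly smooth in `(t, x₀)` is the smooth dependence of integral curves on their
initial values; it follows from the implicit function theorem, applied to the integral equation
rescaled to the unit time interval.
-/

noncomputable section

namespace WKB

open Filter Topology

section Superposition

variable {K : Type*} [TopologicalSpace K] [CompactSpace K]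

/-- The pointwise action of a continuous family of operators on a continuous function, as a
bounded bilinear map. It provides the derivative of the superposition operator `v ↦ f ∘ v`. -/
def pointwiseApply (K : Type*) [TopologicalSpace K] [CompactSpace K]
    (E F : Type*) [NormedAddCommGroup E] [NormedSpace ℝ E] [NormedAddCommGroup F]
    [NormedSpace ℝ F] : C(K, E →L[ℝ] F) →L[ℝ] C(K, E) →L[ℝ] C(K, F) :=
  LinearMap.mkContinuous₂
    (LinearMap.mk₂ ℝ (fun (g : C(K, E →L[ℝ] F)) (u : C(K, E)) =>
        (⟨fun s => g s (u s), by fun_prop⟩ : C(K, F)))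
      (by intros; ext; simp) (by intros; ext; simp) (by intros; ext; simp)
      (by intros; ext; simp))
    1 (by
      intro g u
      refine (ContinuousMap.norm_le _ (by positivity)).2 fun s => ?_
      rw [one_mul]
      exact (g s).le_of_opNorm_le_of_le (g.norm_coe_le_norm s) (u.norm_coe_le_norm s))

theorem hasFDerivAt_superposition {E F : Type*} [NormedAddCommGroup E] [NormedSpace ℝ E]
    [NormedAddCommGroup F] [NormedSpace ℝ F] (f : C(E, F)) (f' : C(E, E →L[ℝ] F))
    (hf : ∀ x, HasFDerivAt f (f' x) x) (u : C(K, E)) :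
    HasFDerivAt (fun v : C(K, E) => f.comp v) (pointwiseApply K E F (f'.comp u)) u := by
  rw [hasFDerivAt_iff_isLittleO, Asymptotics.isLittleO_iff]
  intro c hc
  have hcont := (ContinuousMap.continuous_postcomp (X := K) f').continuousAt (x := u)
  obtain ⟨δ, hδ, hball⟩ := (Metric.continuousAt_iff (α := C(K, E))
    (β := C(K, E →L[ℝ] F))).1 hcont c hc
  have uniform : ∀ (s : K) (h : E), ‖h‖ < δ → ‖f' (u s + h) - f' (u s)‖ ≤ c := by
    intro s h hh
    have hdist : dist (u + ContinuousMap.const K h) u < δ := by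
      rw [dist_eq_norm, add_sub_cancel_left]
      exact ((ContinuousMap.norm_le _ (norm_nonneg h)).2 fun _ => le_rfl).trans_lt hh
    simpa [dist_eq_norm] using (ContinuousMap.dist_apply_le_dist s).trans (hball hdist).le
  filter_upwards [Metric.ball_mem_nhds u hδ] with v hv
  refine (ContinuousMap.norm_le _ (by positivity)).2 fun s => ?_
  have hvs : ‖v s - u s‖ ≤ ‖v - u‖ := (v - u).norm_coe_le_norm s
  have hmv := Convex.norm_image_sub_le_of_norm_hasFDerivWithin_le' (𝕜 := ℝ) (f := f) (f' := f')
    (φ := f' (u s)) (C := c) (s := Metric.ball (u s) δ) (x := u s) (y := v s)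
    (fun x _ => (hf x).hasFDerivWithinAt)
    (fun x hx => by simpa using uniform s (x - u s) (by rwa [← dist_eq_norm]))
    (convex_ball _ _) (Metric.mem_ball_self hδ)
    (by simpa [dist_eq_norm] using hvs.trans_lt (by rwa [← dist_eq_norm]))
  exact hmv.trans (by gcongr)

universe w

theorem contDiff_superposition {E : Type w} [NormedAddCommGroup E] [NormedSpace ℝ E] (n : ℕ) :
    ∀ {F : Type w} [NormedAddCommGroup F] [NormedSpace ℝ F] (f : C(E, F)),
      ContDiff ℝ n f → ContDiff ℝ n (fun v : C(K, E) => f.comp v) := by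
  induction n with
  | zero =>
    intro F _ _ f _
    rw [Nat.cast_zero, contDiff_zero]
    exact ContinuousMap.continuous_postcomp f
  | succ n ih =>
    intro F _ _ f hf
    rw [Nat.cast_succ] at hf ⊢
    obtain ⟨f', hf', hd⟩ := contDiff_succ_iff_hasFDerivAt.1 hf
    exact contDiff_succ_iff_hasFDerivAt.2
      ⟨_, (pointwiseApply K E F).contDiff.comp (ih ⟨f', hf'.continuous⟩ hf'),
        hasFDerivAt_superposition f ⟨f', hf'.continuous⟩ hd⟩

end Superposition

section IntegralCurves

variable {E : Type*} [NormedAddCommGroup E] [NormedSpace ℝ E]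

/-- The operator `u ↦ (s ↦ ∫₀ˢ u)` on continuous functions on the unit interval. -/
def unitPrimitive (E : Type*) [NormedAddCommGroup E] [NormedSpace ℝ E] :
    C(unitInterval, E) →L[ℝ] C(unitInterval, E) :=
  LinearMap.mkContinuous
    { toFun := fun u => ⟨fun s => ∫ r in (0 : ℝ)..s, u.IccExtend zero_le_one r,
        (intervalIntegral.continuous_primitive
          (fun _ _ => (u.IccExtend _).continuous.intervalIntegrable _ _) 0).comp
            continuous_subtype_val⟩
      map_add' := fun u v => ContinuousMap.ext fun s => intervalIntegral.integral_add
        ((u.IccExtend _).continuous.intervalIntegrable _ _)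
        ((v.IccExtend _).continuous.intervalIntegrable _ _)
      map_smul' := fun c u => ContinuousMap.ext fun s =>
        intervalIntegral.integral_smul c (u.IccExtend zero_le_one) }
    1 (by
      intro u
      refine (ContinuousMap.norm_le _ (by positivity)).2 fun s => ?_
      refine (intervalIntegral.norm_integral_le_of_norm_le_const (C := ‖u‖)
        fun r _ => u.norm_coe_le_norm _).trans ?_
      rw [sub_zero, abs_of_nonneg s.2.1, mul_comm]
      exact mul_le_mul_of_nonneg_right s.2.2 (norm_nonneg u))

/-- The defect `u - y - ε ∫₀ f(u)` in the integral equation of `u' = ε f(u)`, `u(0) = y`, on the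
unit interval, as a function of `((ε, y), u)`. Rescaling time by `ε` lets all integral curves of
`f` live on the same interval. -/
def picardDefect (f : C(E, E)) (w : (ℝ × E) × C(unitInterval, E)) : C(unitInterval, E) :=
  w.2 - ContinuousLinearMap.const ℝ unitInterval w.1.2 - w.1.1 • unitPrimitive E (f.comp w.2)

theorem contDiff_picardDefect {n : ℕ} {f : C(E, E)} (hf : ContDiff ℝ n f) :
    ContDiff ℝ n (picardDefect f) := by
  have hsuper := contDiff_superposition (K := unitInterval) n f hf
  refine (contDiff_snd.sub ((ContinuousLinearMap.const ℝ unitInterval :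
    E →L[ℝ] C(unitInterval, E)).contDiff.comp (contDiff_snd.comp contDiff_fst))).sub ?_
  exact (contDiff_fst.comp contDiff_fst).smul
    ((unitPrimitive E).contDiff.comp (hsuper.comp contDiff_snd))

theorem fderiv_picardDefect_comp_inr {f : C(E, E)} (hf : ContDiff ℝ 1 f) (y : E)
    (u : C(unitInterval, E)) :
    fderiv ℝ (picardDefect f) ((0, y), u) ∘L .inr ℝ (ℝ × E) C(unitInterval, E) =
      ContinuousLinearMap.id ℝ C(unitInterval, E) := by
  have hdefect : HasFDerivAt (fun v => picardDefect f ((0, y), v))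
      (fderiv ℝ (picardDefect f) ((0, y), u) ∘L .inr ℝ (ℝ × E) C(unitInterval, E)) u :=
    ((contDiff_picardDefect (E := E) (n := 1) (by exact_mod_cast hf)).differentiable (by simp)
      _).hasFDerivAt.comp u (hasFDerivAt_prodMk_right _ _)
  refine hdefect.unique ?_
  simpa [picardDefect] using (hasFDerivAt_id u).sub_const
    (ContinuousLinearMap.const ℝ unitInterval y)

theorem eqOn_unitInterval_of_hasDerivAt {g : E → E} (hg : ContDiff ℝ 1 g) {u v : ℝ → E}
    (hu : ∀ s ∈ unitInterval, HasDerivAt u (g (u s)) s)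
    (hv : ∀ s ∈ unitInterval, HasDerivAt v (g (v s)) s) (h0 : u 0 = v 0) :
    EqOn u v unitInterval := by
  have hcu : ContinuousOn u (Icc 0 1) := fun s hs => (hu s hs).continuousAt.continuousWithinAt
  have hcv : ContinuousOn v (Icc 0 1) := fun s hs => (hv s hs).continuousAt.continuousWithinAt
  obtain ⟨L, hL⟩ := (hg.locallyLipschitz.locallyLipschitzOn
    (s := u '' Icc 0 1 ∪ v '' Icc 0 1)).exists_lipschitzOnWith_of_compact
    ((isCompact_Icc.image_of_continuousOn hcu).union (isCompact_Icc.image_of_continuousOn hcv))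
  exact ODE_solution_unique_of_mem_Icc_right (v := fun _ => g) (s := fun _ => _)
    (fun _ _ => hL) hcu (fun s hs => (hu s (Ico_subset_Icc_self hs)).hasDerivWithinAt)
    (fun s hs => Or.inl (mem_image_of_mem _ (Ico_subset_Icc_self hs))) hcv
    (fun s hs => (hv s (Ico_subset_Icc_self hs)).hasDerivWithinAt)
    (fun s hs => Or.inr (mem_image_of_mem _ (Ico_subset_Icc_self hs))) h0

theorem eq_of_picardDefect_eq_zero [CompleteSpace E] {f : C(E, E)} (hf : ContDiff ℝ 1 f) {ε : ℝ}
    {y : E} {u : C(unitInterval, E)} (hu : picardDefect f ((ε, y), u) = 0) {v : ℝ → E}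
    (hv0 : v 0 = y) (hv : ∀ s ∈ unitInterval, HasDerivAt v (ε • f (v s)) s) : v 1 = u 1 := by
  let U : ℝ → E := fun s => y + ε • ∫ r in (0 : ℝ)..s, (f.comp u).IccExtend zero_le_one r
  have U_eq : ∀ s (hs : s ∈ unitInterval), U s = u ⟨s, hs⟩ := by
    intro s hs
    have hs0 := DFunLike.congr_fun hu ⟨s, hs⟩
    rw [picardDefect, sub_sub] at hs0
    exact (sub_eq_zero.1 hs0).symm
  have hasDerivAt_U : ∀ s ∈ unitInterval, HasDerivAt U (ε • f (U s)) s := by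
    intro s hs
    have hint : (f.comp u).IccExtend zero_le_one s = f (U s) := by
      rw [U_eq s hs, ContinuousMap.coe_IccExtend, IccExtend_of_mem _ _ hs]
      rfl
    rw [← hint]
    exact ((((f.comp u).IccExtend _).continuous.integral_hasStrictDerivAt 0
      s).hasDerivAt.const_smul ε).const_add y
  have hUv := eqOn_unitInterval_of_hasDerivAt (g := fun z => ε • f z) (contDiff_const.smul hf) hv
    hasDerivAt_U (by simp [U, hv0])
  exact (hUv unitInterval.one_mem).trans (U_eq 1 unitInterval.one_mem)

theorem hasDerivAt_comp_mul_of_integralCurve {f γ : ℝ → E} {ε : ℝ}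
    (hγ : ∀ t ∈ uIcc 0 ε, HasDerivAt γ (f t) t) {s : ℝ} (hs : s ∈ unitInterval) :
    HasDerivAt (fun r => γ (ε * r)) (ε • f (ε * s)) s := by
  have hmem : ε * s ∈ uIcc 0 ε := by
    simpa [AffineMap.lineMap_apply, mul_comm] using
      (convex_uIcc (0 : ℝ) ε).lineMap_mem left_mem_uIcc right_mem_uIcc hs
  exact (hγ _ hmem).scomp s (by simpa using (hasDerivAt_id s).const_mul ε)

/-- The curve starting at `y` reaches at time `ε` the value at `1` of the solution of
`u' = ε f(u)`, `u(0) = y`; at `ε = 0` the implicit function theorem solves for `u`. -/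
theorem exists_contDiffAt_localFlow [CompleteSpace E] {f : E → E} {n : ℕ} (hn : 1 ≤ n)
    (hf : ContDiff ℝ n f) (y₀ : E) :
    ∃ Φ : ℝ × E → E, ContDiffAt ℝ n Φ (0, y₀) ∧
      ∀ᶠ w : ℝ × E in 𝓝 (0, y₀), ∀ γ : ℝ → E, γ 0 = w.2 →
        (∀ t ∈ uIcc 0 w.1, HasDerivAt γ (f (γ t)) t) → γ w.1 = Φ w := by
  let g : C(E, E) := ⟨f, hf.continuous⟩
  let w₀ : (ℝ × E) × C(unitInterval, E) := ((0, y₀), ContinuousLinearMap.const ℝ _ y₀)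
  have hf1 : ContDiff ℝ 1 f := hf.of_le (by exact_mod_cast hn)
  have hn0 : (n : WithTop ℕ∞) ≠ 0 := by simpa using Nat.one_le_iff_ne_zero.1 hn
  have hdefect : ContDiffAt ℝ n (picardDefect g) w₀ := (contDiff_picardDefect hf).contDiffAt
  have hzero : picardDefect g w₀ = 0 := by simp [picardDefect, w₀]
  have hinv : (fderiv ℝ (picardDefect g) w₀ ∘L .inr ℝ (ℝ × E) C(unitInterval, E)).IsInvertible :=
    ⟨.refl ℝ _, (fderiv_picardDefect_comp_inr hf1 y₀ _).symm⟩
  refine ⟨fun w => hdefect.implicitFunction hn0 hinv w 1,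
    (ContinuousMap.evalCLM ℝ (1 : unitInterval) :
      C(unitInterval, E) →L[ℝ] E).contDiff.contDiffAt.comp _
      (hdefect.contDiffAt_implicitFunction hn0 hinv), ?_⟩
  filter_upwards [hdefect.eventually_apply_implicitFunction hn0 hinv] with w hw γ hγ0 hγ
  simpa only [mul_one] using eq_of_picardDefect_eq_zero (f := g) hf1 (hw.trans hzero)
    (v := fun s => γ (w.1 * s)) (by simpa using hγ0)
    fun s hs => hasDerivAt_comp_mul_of_integralCurve hγ hs

variable [CompleteSpace E] {P : Type*} [NormedAddCommGroup P] [NormedSpace ℝ P] {I : Set ℝ}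
  {γ : ℝ → P → E} {q : P}

theorem eventually_contDiffAt_integralCurves {f : E → E} {n : ℕ} (hn : 1 ≤ n)
    (hf : ContDiff ℝ n f) (hI : IsOpen I) (hIc : I.OrdConnected)
    (hγ : ∀ p, ∀ t ∈ I, HasDerivAt (fun s => γ s p) (f (γ t p)) t) {τ : ℝ} (hτ : τ ∈ I) :
    ∀ᶠ w : ℝ × ℝ in 𝓝 (τ, τ), ContDiffAt ℝ n (γ w.1) q →
      ContDiffAt ℝ n (fun z : ℝ × P => γ z.1 z.2) (w.2, q) := by
  obtain ⟨Φ, hΦ, hflow⟩ := exists_contDiffAt_localFlow hn hf (γ τ q)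
  have hlim : Tendsto (fun w : ℝ × ℝ => (w.2 - w.1, γ w.1 q)) (𝓝 (τ, τ)) (𝓝 (0, γ τ q)) := by
    have hγτ := (hγ q τ hτ).continuousAt
    have : ContinuousAt (fun w : ℝ × ℝ => (w.2 - w.1, γ w.1 q)) (τ, τ) :=
      (continuousAt_snd.sub continuousAt_fst).prodMk
        (ContinuousAt.comp (g := fun s => γ s q) (f := Prod.fst) hγτ continuousAt_fst)
    simpa [ContinuousAt] using this
  filter_upwards [hlim.eventually (hflow.eventually_nhds.and (hΦ.eventually (by simp))),
    (hI.prod hI).mem_nhds ⟨hτ, hτ⟩] with ⟨s, r⟩ ⟨hflow_s, hΦ_s⟩ ⟨hs, hr⟩ hγs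
  let W : ℝ × P → ℝ × E := fun z => (z.1 - s, γ s z.2)
  have hW : ContDiffAt ℝ n W (r, q) :=
    (contDiffAt_fst.sub contDiffAt_const).prodMk (hγs.comp (r, q) contDiffAt_snd)
  refine (hΦ_s.comp (r, q) hW).congr_of_eventuallyEq ?_
  filter_upwards [hW.continuousAt.eventually hflow_s,
    continuousAt_fst.eventually (hI.mem_nhds hr)] with z hz hzI
  have hshift : ∀ σ ∈ uIcc 0 (z.1 - s), s + σ ∈ I := fun σ hσ =>
    hIc.uIcc_subset hs hzI (by simpa using (mem_image_of_mem (s + ·) hσ))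
  simpa [W] using hz (fun σ => γ (s + σ) z.2) (by simp [W])
    fun σ hσ => (hγ z.2 _ (hshift σ hσ)).comp_const_add s σ

theorem contDiffAt_integralCurves {f : E → E} (hf : ContDiff ℝ ∞ f) (hI : IsOpen I)
    (hIc : I.OrdConnected) (hγ : ∀ p, ∀ t ∈ I, HasDerivAt (fun s => γ s p) (f (γ t p)) t)
    {t₀ t : ℝ} (ht₀ : t₀ ∈ I) (ht : t ∈ I) (h₀ : ContDiffAt ℝ ∞ (γ t₀) q) :
    ContDiffAt ℝ ∞ (fun z : ℝ × P => γ z.1 z.2) (t, q) := by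
  suffices hfinite : ∀ n : ℕ, 1 ≤ n → ContDiffAt ℝ n (fun z : ℝ × P => γ z.1 z.2) (t, q) from
    contDiffAt_infty.2 fun n => (hfinite (n + 1) (by simp)).of_le (by simp)
  intro n hn
  have hlocal (τ) (hτ : τ ∈ I) := eventually_contDiffAt_integralCurves (q := q) hn
    (hf.of_le (by exact_mod_cast le_top)) hI hIc hγ hτ
  have hslice : ∀ τ, ContDiffAt ℝ n (fun z : ℝ × P => γ z.1 z.2) (τ, q) →
      ContDiffAt ℝ n (γ τ) q := fun τ hτ => hτ.comp q (contDiffAt_const.prodMk contDiffAt_id)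
  have hpropagate : ContDiffAt ℝ n (γ t₀) q → ContDiffAt ℝ n (γ t) q := by
    refine hIc.isPreconnected.induction₂'
      (fun s r => ContDiffAt ℝ n (γ s) q → ContDiffAt ℝ n (γ r) q) (fun τ hτ => ?_)
      (fun _ _ _ _ _ _ hxy hyz => hyz ∘ hxy) ht₀ ht
    have hright := (Continuous.prodMk_right τ).continuousAt.eventually (hlocal τ hτ)
    have hleft := (Continuous.prodMk_left τ).continuousAt.eventually (hlocal τ hτ)
    filter_upwards [nhdsWithin_le_nhds hright, nhdsWithin_le_nhds hleft] with r hr hl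
    exact ⟨hslice r ∘ hr, hslice τ ∘ hl⟩
  exact (hlocal t ht).self_of_nhds (hpropagate (h₀.of_le (by exact_mod_cast le_top)))

end IntegralCurves

section SpaceTimeCalculus

variable {E F : Type*} [NormedAddCommGroup E] [NormedSpace ℝ E] [NormedAddCommGroup F]
  [NormedSpace ℝ F] {g : ℝ × E → F} {z : ℝ × E}

theorem hasDerivAt_timeSlice {L : ℝ × E →L[ℝ] F} (h : HasFDerivAt g L z) :
    HasDerivAt (fun s => g (s, z.2)) (L (1, 0)) z.1 :=
  h.comp_hasDerivAt (f := fun s => (s, z.2)) z.1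
    ((hasDerivAt_id z.1).prodMk (hasDerivAt_const z.1 z.2))

theorem hasFDerivAt_spaceSlice {L : ℝ × E →L[ℝ] F} (h : HasFDerivAt g L z) :
    HasFDerivAt (fun y => g (z.1, y)) (L ∘L .inr ℝ ℝ E) z.2 :=
  h.comp (f := fun y => (z.1, y)) z.2 (hasFDerivAt_prodMk_right z.1 z.2)

theorem hasDerivAt_fderiv_space (hg : ContDiffAt ℝ 2 g z) (w : E) :
    HasDerivAt (fun s => fderiv ℝ g (s, z.2) (0, w))
      (fderiv ℝ (fun y => fderiv ℝ g y (1, 0)) z (0, w)) z.1 := by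
  have hD : HasFDerivAt (fderiv ℝ g) (fderiv ℝ (fderiv ℝ g) z) z :=
    ((hg.fderiv_right (m := 1) (by norm_num)).differentiableAt (by simp)).hasFDerivAt
  have hspace : fderiv ℝ (fun y => fderiv ℝ g y (1, 0)) z (0, w) =
      fderiv ℝ (fderiv ℝ g) z (0, w) (1, 0) := by
    simp [(hD.clm_apply (hasFDerivAt_const _ z)).fderiv]
  rw [hspace, hg.isSymmSndFDerivAt (by simp) (0, w) (1, 0)]
  simpa using (hasDerivAt_timeSlice hD).clm_apply (hasDerivAt_const z.1 ((0 : ℝ), w))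

end SpaceTimeCalculus

section TimePrimitive

variable {F : Type*} [NormedAddCommGroup F] [NormedSpace ℝ F]

/-- The primitive in time of a function of time and space, normalized to vanish at time `0`. -/
def timePrimitive {Y : Type*} (g : ℝ × Y → F) (z : ℝ × Y) : F := ∫ r in (0 : ℝ)..z.1, g (r, z.2)

@[simp]
theorem timePrimitive_zero_left {Y : Type*} (g : ℝ × Y → F) (y : Y) : timePrimitive g (0, y) = 0 :=
  intervalIntegral.integral_same

variable {I : Set ℝ}

theorem hasDerivAt_timePrimitive [CompleteSpace F] {Y : Type*} [TopologicalSpace Y]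
    {g : ℝ × Y → F} {z : ℝ × Y} (hI : IsOpen I) (hIc : I.OrdConnected) (h0 : 0 ∈ I)
    (hg : ContinuousOn g (I ×ˢ univ)) (hz : z.1 ∈ I) :
    HasDerivAt (fun s => timePrimitive g (s, z.2)) (g z) z.1 := by
  have hslice : ContinuousOn (fun r : ℝ => g (r, z.2)) I :=
    hg.comp (by fun_prop) fun r hr => ⟨hr, mem_univ _⟩
  exact intervalIntegral.integral_hasDerivAt_right
    ((hslice.mono (hIc.uIcc_subset h0 hz)).intervalIntegrable)
    (hslice.stronglyMeasurableAtFilter hI _ hz) (hslice.continuousAt (hI.mem_nhds hz))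

variable {E : Type*} [NormedAddCommGroup E] [NormedSpace ℝ E] {g : ℝ × E → F}

/-- The curves `t ↦ (t, y, ∫₀ᵗ g(r, y) dr)` are the integral curves of the smooth vector field
`(1, 0, g)`. -/
theorem contDiff_timePrimitive [CompleteSpace E] [CompleteSpace F] (hg : ContDiff ℝ ∞ g) :
    ContDiff ℝ ∞ (timePrimitive g) := by
  let γ : ℝ → E → ℝ × E × F := fun t y => (t, y, timePrimitive g (t, y))
  have hfield : ContDiff ℝ ∞ fun w : ℝ × E × F => ((1 : ℝ), (0 : E), g (w.1, w.2.1)) := by fun_prop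
  have hγ : ∀ y, ∀ t ∈ univ, HasDerivAt (fun s => γ s y) (1, 0, g (t, y)) t := fun y t ht =>
    (hasDerivAt_id t).prodMk ((hasDerivAt_const t y).prodMk (hasDerivAt_timePrimitive (z := (t, y))
      isOpen_univ ordConnected_univ (mem_univ 0) hg.continuous.continuousOn ht))
  have hγ0 : ContDiff ℝ ∞ (γ 0) := by
    simp only [γ, timePrimitive_zero_left]
    fun_prop
  exact contDiff_iff_contDiffAt.2 fun z => (contDiffAt_integralCurves hfield isOpen_univ
    ordConnected_univ hγ (mem_univ 0) (mem_univ z.1) hγ0.contDiffAt).snd.snd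

theorem contDiff_smul_of_eventually_eq_zero {χ : ℝ → ℝ} (hχ : ContDiff ℝ ∞ χ)
    (hχI : ∀ t ∉ I, ∀ᶠ s in 𝓝 t, χ s = 0) (hI : IsOpen I) (hg : ContDiffOn ℝ ∞ g (I ×ˢ univ)) :
    ContDiff ℝ ∞ fun z => χ z.1 • g z := by
  refine contDiff_iff_contDiffAt.2 fun z => ?_
  by_cases hz : z.1 ∈ I
  · exact (hχ.comp contDiff_fst).contDiffAt.smul
      (hg.contDiffAt ((hI.prod isOpen_univ).mem_nhds ⟨hz, mem_univ _⟩))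
  · refine (contDiffAt_const (c := (0 : F))).congr_of_eventuallyEq ?_
    filter_upwards [continuousAt_fst.eventually (hχI z.1 hz)] with w hw
    rw [hw, zero_smul]

theorem contDiffOn_timePrimitive [CompleteSpace E] [CompleteSpace F] (hI : IsOpen I)
    (hIc : I.OrdConnected) (h0 : 0 ∈ I) (hg : ContDiffOn ℝ ∞ g (I ×ˢ univ)) :
    ContDiffOn ℝ ∞ (timePrimitive g) (I ×ˢ univ) := by
  rw [(hI.prod isOpen_univ).contDiffOn_iff]
  rintro z ⟨hz, -⟩
  obtain ⟨χ, hχ0, hχ1, -⟩ := exists_contMDiffMap_zero_one_nhds_of_isClosed (n := ⊤) 𝓘(ℝ, ℝ)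
    hI.isClosed_compl (isCompact_uIcc (a := 0) (b := z.1)).isClosed
    (disjoint_compl_left_iff_subset.2 (hIc.uIcc_subset h0 hz))
  refine (contDiff_timePrimitive (contDiff_smul_of_eventually_eq_zero χ.contMDiff.contDiff
    (fun t ht => (eventually_nhdsSet_iff_forall.1 hχ0) t ht) hI
    hg)).contDiffAt.congr_of_eventuallyEq ?_
  have hχz : ∀ᶠ t in 𝓝 z.1, ∀ r ∈ uIcc z.1 t, χ r = 1 :=
    (tendsto_const_nhds.uIcc tendsto_id).eventually
      (eventually_smallSets_forall.2 (eventually_nhdsSet_iff_forall.1 hχ1 _ right_mem_uIcc))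
  filter_upwards [continuousAt_fst.eventually hχz] with w hw
  refine intervalIntegral.integral_congr fun r hr => ?_
  have : χ r = 1 := (uIcc_subset_uIcc_union_uIcc hr).elim (hχ1.self_of_nhdsSet r) (hw r)
  simp [this]

end TimePrimitive

section InverseFunction

variable {E F : Type*} [NormedAddCommGroup E] [NormedSpace ℝ E] [NormedAddCommGroup F]
  [NormedSpace ℝ F]

theorem contDiffOn_image_of_leftInvOn [CompleteSpace E] {n : ℕ∞ω} {f : E → F} {g : F → E}
    {U : Set E} (hn : n ≠ 0) (hU : IsOpen U) (hf : ContDiffOn ℝ n f U)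
    (hinv : ∀ x ∈ U, (fderiv ℝ f x).IsInvertible) (hg : LeftInvOn g f U) :
    ContDiffOn ℝ n g (f '' U) := by
  rintro _ ⟨x, hx, rfl⟩
  have hfx : ContDiffAt ℝ n f x := hf.contDiffAt (hU.mem_nhds hx)
  obtain ⟨L, hL⟩ := hinv x hx
  have hLx : HasFDerivAt f (L : E →L[ℝ] F) x := hL ▸ (hfx.differentiableAt hn).hasFDerivAt
  have hsmooth := hfx.to_localInverse hLx hn
  have hmem : ∀ᶠ y in 𝓝 (f x), hfx.localInverse hLx hn y ∈ U :=
    hsmooth.continuousAt.eventually <|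
      (hfx.localInverse_apply_image hLx hn).symm ▸ hU.mem_nhds hx
  refine (hsmooth.congr_of_eventuallyEq ?_).contDiffWithinAt
  filter_upwards [hmem, (hfx.hasStrictFDerivAt' hLx hn).eventually_right_inverse] with y hyU hy
  exact (congrArg g hy).symm.trans (hg hyU)

end InverseFunction

section SmoothFlow

variable {E F : Type*} [NormedAddCommGroup E] [NormedSpace ℝ E] [NormedAddCommGroup F]
  [NormedSpace ℝ F] {I : Set ℝ} {X Q : ℝ × E → E} {z : ℝ × E}

/-- The map `(t, q) ↦ (t, X(t, q))` of space-time given by a family of maps of space. -/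
def spaceTimeMap {Y Z : Type*} (X : ℝ × Y → Z) (z : ℝ × Y) : ℝ × Z := (z.1, X z)

/-- For `t ∈ I` the maps `X(t, ·)` and `Q(t, ·)` are mutually inverse diffeomorphisms, and both
depend smoothly on `t`. We think of `X(t, q)` as the position at time `t` of the particle with
label `q`, and of `Q(t, y)` as the label of the particle that is at `y` at time `t`. -/
structure IsSmoothFlow (I : Set ℝ) (X Q : ℝ × E → E) : Prop where
  smooth : ContDiffOn ℝ ∞ X (I ×ˢ univ)
  smooth_label : ContDiffOn ℝ ∞ Q (I ×ˢ univ)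
  label_apply : ∀ z : ℝ × E, z.1 ∈ I → Q (spaceTimeMap X z) = z.2
  apply_label : ∀ z : ℝ × E, z.1 ∈ I → X (spaceTimeMap Q z) = z.2

theorem mapsTo_spaceTimeMap {Y Z : Type*} (I : Set ℝ) (X : ℝ × Y → Z) :
    MapsTo (spaceTimeMap X) (I ×ˢ univ) (I ×ˢ univ) :=
  fun _ hz => ⟨hz.1, mem_univ _⟩

theorem contDiffOn_spaceTimeMap (hX : ContDiffOn ℝ ∞ X (I ×ˢ univ)) :
    ContDiffOn ℝ ∞ (spaceTimeMap X) (I ×ˢ univ) :=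
  contDiffOn_fst.prodMk hX

theorem contDiffOn_comp_spaceTimeMap {g : ℝ × E → F} (hg : ContDiffOn ℝ ∞ g (I ×ˢ univ))
    (hX : ContDiffOn ℝ ∞ X (I ×ˢ univ)) :
    ContDiffOn ℝ ∞ (fun z => g (spaceTimeMap X z)) (I ×ˢ univ) :=
  hg.comp (contDiffOn_spaceTimeMap hX) (mapsTo_spaceTimeMap I X)

theorem contDiffAt_of_contDiffOn_prod_univ {g : ℝ × E → F} {n : ℕ∞ω} (hI : IsOpen I)
    (hg : ContDiffOn ℝ n g (I ×ˢ univ)) (hz : z.1 ∈ I) : ContDiffAt ℝ n g z :=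
  hg.contDiffAt ((hI.prod isOpen_univ).mem_nhds ⟨hz, mem_univ _⟩)

theorem hasFDerivAt_of_contDiffOn_prod_univ {g : ℝ × E → F} (hI : IsOpen I)
    (hg : ContDiffOn ℝ ∞ g (I ×ˢ univ)) (hz : z.1 ∈ I) : HasFDerivAt g (fderiv ℝ g z) z :=
  ((contDiffAt_of_contDiffOn_prod_univ hI hg hz).differentiableAt (by simp)).hasFDerivAt

theorem hasFDerivAt_spaceTimeMap {X : ℝ × E → F} {L : ℝ × E →L[ℝ] F} (hX : HasFDerivAt X L z) :
    HasFDerivAt (spaceTimeMap X) ((ContinuousLinearMap.fst ℝ ℝ E).prod L) z :=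
  hasFDerivAt_fst.prodMk hX

theorem fderiv_comp_spaceTimeMap {g : ℝ × E → F} (hI : IsOpen I)
    (hg : ContDiffOn ℝ ∞ g (I ×ˢ univ)) (hX : ContDiffOn ℝ ∞ X (I ×ˢ univ)) (hz : z.1 ∈ I)
    (v : ℝ × E) :
    fderiv ℝ (fun y => g (spaceTimeMap X y)) z v =
      fderiv ℝ g (spaceTimeMap X z) (v.1, fderiv ℝ X z v) :=
  have hgz := hasFDerivAt_of_contDiffOn_prod_univ (z := spaceTimeMap X z) hI hg hz
  have hXz := hasFDerivAt_of_contDiffOn_prod_univ hI hX hz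
  congrArg (· v) (hgz.comp z (hasFDerivAt_spaceTimeMap hXz)).fderiv

namespace IsSmoothFlow

theorem symm (h : IsSmoothFlow I X Q) : IsSmoothFlow I Q X :=
  ⟨h.smooth_label, h.smooth, h.apply_label, h.label_apply⟩

theorem spaceTimeMap_label (h : IsSmoothFlow I X Q) (hz : z.1 ∈ I) :
    spaceTimeMap X (spaceTimeMap Q z) = z :=
  Prod.ext rfl (h.apply_label z hz)

theorem fderiv_apply_label (h : IsSmoothFlow I X Q) (hI : IsOpen I) (hz : z.1 ∈ I) (v : ℝ × E) :
    fderiv ℝ X (spaceTimeMap Q z) (v.1, fderiv ℝ Q z v) = v.2 := by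
  rw [← fderiv_comp_spaceTimeMap hI h.smooth h.smooth_label hz]
  have heq : (fun y => X (spaceTimeMap Q y)) =ᶠ[𝓝 z] Prod.snd := by
    filter_upwards [continuousAt_fst.eventually (hI.mem_nhds hz)] with y hy
    exact h.apply_label y hy
  simp [heq.fderiv_eq, fderiv_snd]

end IsSmoothFlow

theorem isInvertible_fderiv_spaceTimeMap (hI : IsOpen I) (hX : ContDiffOn ℝ ∞ X (I ×ˢ univ))
    (hz : z.1 ∈ I) (hinv : (fderiv ℝ (fun q => X (z.1, q)) z.2).IsInvertible) :
    (fderiv ℝ (spaceTimeMap X) z).IsInvertible := by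
  have hXz := hasFDerivAt_of_contDiffOn_prod_univ hI hX hz
  obtain ⟨L, hL⟩ := hinv
  refine ⟨(ContinuousLinearEquiv.refl ℝ ℝ).skewProd L (fderiv ℝ X z ∘L .inl ℝ ℝ E), ?_⟩
  rw [(hasFDerivAt_spaceTimeMap hXz).fderiv]
  refine ContinuousLinearMap.ext fun v => Prod.ext rfl ?_
  have hLv : L v.2 = fderiv ℝ X z (0, v.2) := by
    simpa [(hasFDerivAt_spaceSlice hXz).fderiv] using congrArg (· v.2) hL
  simp [hLv, ← map_add]

theorem exists_isSmoothFlow [CompleteSpace E] (hI : IsOpen I) (hX : ContDiffOn ℝ ∞ X (I ×ˢ univ))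
    (hdiffeo : ∀ t ∈ I, ∃ Φ : Diffeomorph 𝓘(ℝ, E) 𝓘(ℝ, E) E E ∞, ∀ q, Φ q = X (t, q)) :
    ∃ Q : ℝ × E → E, IsSmoothFlow I X Q := by
  have : Nonempty (Diffeomorph 𝓘(ℝ, E) 𝓘(ℝ, E) E E ∞) := ⟨.refl _ _ _⟩
  choose! Φ hΦ using hdiffeo
  have hslice : ∀ t ∈ I, ⇑(Φ t) = fun q => X (t, q) := fun t ht => funext (hΦ t ht)
  let Q : ℝ × E → E := fun z => (Φ z.1).symm z.2
  have hleft : ∀ z : ℝ × E, z.1 ∈ I → Q (spaceTimeMap X z) = z.2 := fun z hz =>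
    (congrArg (Φ z.1).symm (hΦ z.1 hz z.2).symm).trans ((Φ z.1).symm_apply_apply z.2)
  have hright : ∀ z : ℝ × E, z.1 ∈ I → X (spaceTimeMap Q z) = z.2 := fun z hz =>
    (hΦ z.1 hz _).symm.trans ((Φ z.1).apply_symm_apply z.2)
  have hinv : ∀ z ∈ I ×ˢ univ, (fderiv ℝ (spaceTimeMap X) z).IsInvertible := by
    refine fun z hz => isInvertible_fderiv_spaceTimeMap hI hX hz.1 ?_
    rw [← hslice z.1 hz.1, ← mfderiv_eq_fderiv]
    exact ⟨(Φ z.1).mfderivToContinuousLinearEquiv (by simp) z.2, rfl⟩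
  have himage : spaceTimeMap X '' (I ×ˢ univ) = I ×ˢ univ :=
    (mapsTo_spaceTimeMap I X).image_subset.antisymm fun z hz =>
      ⟨spaceTimeMap Q z, mapsTo_spaceTimeMap I Q hz, Prod.ext rfl (hright z hz.1)⟩
  have hQ := contDiffOn_image_of_leftInvOn (by simp) (hI.prod isOpen_univ)
    (contDiffOn_spaceTimeMap hX) hinv (g := spaceTimeMap Q)
    fun z hz => Prod.ext rfl (hleft z hz.1)
  exact ⟨Q, hX, (himage ▸ hQ).snd, hleft, hright⟩

end SmoothFlow

section Gradients

variable {E G : Type*} [NormedAddCommGroup E] [InnerProductSpace ℝ E] [CompleteSpace E]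
  [NormedAddCommGroup G] [NormedSpace ℝ G] {n : ℕ∞ω} {H : ℝ × E × E → ℝ} {w : ℝ × E × E}

theorem contDiff_of_inner_eq_apply {g : G → E} {L : G → E →L[ℝ] ℝ} (hL : ContDiff ℝ n L)
    (hg : ∀ z v, inner ℝ (g z) v = L z v) : ContDiff ℝ n g := by
  have hgL : g = fun z => (InnerProductSpace.toDual ℝ E).symm (L z) :=
    funext fun z => ext_inner_right ℝ fun v => by
      rw [hg, InnerProductSpace.toDual_symm_apply]
  rw [hgL]
  exact (InnerProductSpace.toDual ℝ E).symm.toContinuousLinearEquiv.contDiff.comp hL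

theorem contDiff_gradient {f : E → ℝ} (hf : ContDiff ℝ ∞ f) : ContDiff ℝ ∞ (∇ f) :=
  contDiff_of_inner_eq_apply (hf.fderiv_right le_rfl) fun _ _ => inner_gradient_left

/-- The partial gradient `H_p` of a function of `(t, x, p)`. -/
def momentumGradient (H : ℝ × E × E → ℝ) (w : ℝ × E × E) : E :=
  ∇ (fun p => H (w.1, w.2.1, p)) w.2.2

/-- The partial gradient `H_x` of a function of `(t, x, p)`. -/
def positionGradient (H : ℝ × E × E → ℝ) (w : ℝ × E × E) : E :=
  ∇ (fun x => H (w.1, x, w.2.2)) w.2.1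

theorem inner_momentumGradient (hH : DifferentiableAt ℝ H w) (v : E) :
    inner ℝ (momentumGradient H w) v = fderiv ℝ H w (0, 0, v) := by
  have hslice : HasFDerivAt (fun p => (w.1, w.2.1, p)) (.inr ℝ ℝ (E × E) ∘L .inr ℝ E E) w.2.2 :=
    (hasFDerivAt_prodMk_right w.1 (w.2.1, w.2.2)).comp w.2.2 (hasFDerivAt_prodMk_right w.2.1 w.2.2)
  exact inner_gradient_left.trans (congrArg (· v)
    (hH.hasFDerivAt.comp (f := fun p => (w.1, w.2.1, p)) w.2.2 hslice).fderiv)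

theorem inner_positionGradient (hH : DifferentiableAt ℝ H w) (v : E) :
    inner ℝ (positionGradient H w) v = fderiv ℝ H w (0, v, 0) := by
  have hslice : HasFDerivAt (fun x => (w.1, x, w.2.2)) (.inr ℝ ℝ (E × E) ∘L .inl ℝ E E) w.2.1 :=
    (hasFDerivAt_prodMk_right w.1 (w.2.1, w.2.2)).comp w.2.1 (hasFDerivAt_prodMk_left w.2.1 w.2.2)
  exact inner_gradient_left.trans (congrArg (· v)
    (hH.hasFDerivAt.comp (f := fun x => (w.1, x, w.2.2)) w.2.1 hslice).fderiv)

theorem contDiff_momentumGradient (hH : ContDiff ℝ ∞ H) : ContDiff ℝ ∞ (momentumGradient H) :=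
  contDiff_of_inner_eq_apply
    (L := fun w => fderiv ℝ H w ∘L .inr ℝ ℝ (E × E) ∘L .inr ℝ E E)
    ((hH.fderiv_right le_rfl).clm_comp contDiff_const)
    fun w v => inner_momentumGradient (hH.differentiable (by simp) w) v

theorem contDiff_positionGradient (hH : ContDiff ℝ ∞ H) : ContDiff ℝ ∞ (positionGradient H) :=
  contDiff_of_inner_eq_apply
    (L := fun w => fderiv ℝ H w ∘L .inr ℝ ℝ (E × E) ∘L .inl ℝ E E)
    ((hH.fderiv_right le_rfl).clm_comp contDiff_const)
    fun w v => inner_positionGradient (hH.differentiable (by simp) w) v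

end Gradients

section HamiltonFlow

variable {E : Type*} [NormedAddCommGroup E]

theorem contDiffOn_fderiv_time {F : Type*} [NormedSpace ℝ E] [NormedAddCommGroup F]
    [NormedSpace ℝ F] {I : Set ℝ} {g : ℝ × E → F} (hI : IsOpen I)
    (hg : ContDiffOn ℝ ∞ g (I ×ˢ univ)) :
    ContDiffOn ℝ ∞ (fun z => fderiv ℝ g z (1, 0)) (I ×ˢ univ) :=
  (hg.fderiv_of_isOpen (hI.prod isOpen_univ) le_rfl).clm_apply contDiffOn_const

variable [InnerProductSpace ℝ E]
  {H : ℝ × E × E → ℝ} {S₀ : E → ℝ} {I : Set ℝ} {X P Q : ℝ × E → E} {z : ℝ × E}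

/-- The point `(t, X(t, q), P(t, q))` of extended phase space. -/
def phasePoint {Y : Type*} (X P : ℝ × Y → Y) (z : ℝ × Y) : ℝ × Y × Y := (z.1, X z, P z)

/-- The Lagrangian `⟪p, ẋ⟫ - H` along the trajectories `(X, P)`. -/
def lagrangian (H : ℝ × E × E → ℝ) (X P : ℝ × E → E) (z : ℝ × E) : ℝ :=
  inner ℝ (P z) (fderiv ℝ X z (1, 0)) - H (phasePoint X P z)

/-- The time integral of the Lagrangian along the trajectories `(X, P)`, started from `S₀`. -/
def action (H : ℝ × E × E → ℝ) (S₀ : E → ℝ) (X P : ℝ × E → E) (z : ℝ × E) : ℝ :=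
  S₀ z.2 + timePrimitive (lagrangian H X P) z

theorem contDiffOn_lagrangian (hH : ContDiff ℝ ∞ H) (hI : IsOpen I)
    (hX : ContDiffOn ℝ ∞ X (I ×ˢ univ)) (hP : ContDiffOn ℝ ∞ P (I ×ˢ univ)) :
    ContDiffOn ℝ ∞ (lagrangian H X P) (I ×ˢ univ) :=
  (hP.inner ℝ (contDiffOn_fderiv_time hI hX)).sub
    (hH.comp_contDiffOn (contDiffOn_fst.prodMk (hX.prodMk hP)))

variable [CompleteSpace E]

theorem contDiffOn_action (hH : ContDiff ℝ ∞ H) (hS₀ : ContDiff ℝ ∞ S₀) (hI : IsOpen I)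
    (hIc : I.OrdConnected) (h0 : 0 ∈ I) (hX : ContDiffOn ℝ ∞ X (I ×ˢ univ))
    (hP : ContDiffOn ℝ ∞ P (I ×ˢ univ)) : ContDiffOn ℝ ∞ (action H S₀ X P) (I ×ˢ univ) :=
  (hS₀.comp contDiff_snd).contDiffOn.add
    (contDiffOn_timePrimitive hI hIc h0 (contDiffOn_lagrangian hH hI hX hP))

theorem fderiv_action_time (hH : ContDiff ℝ ∞ H) (hS₀ : ContDiff ℝ ∞ S₀) (hI : IsOpen I)
    (hIc : I.OrdConnected) (h0 : 0 ∈ I) (hX : ContDiffOn ℝ ∞ X (I ×ˢ univ))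
    (hP : ContDiffOn ℝ ∞ P (I ×ˢ univ)) (hz : z.1 ∈ I) :
    fderiv ℝ (action H S₀ X P) z (1, 0) = lagrangian H X P z :=
  (hasDerivAt_timeSlice (hasFDerivAt_of_contDiffOn_prod_univ hI
    (contDiffOn_action hH hS₀ hI hIc h0 hX hP) hz)).unique
    ((hasDerivAt_timePrimitive hI hIc h0 (contDiffOn_lagrangian hH hI hX hP).continuousOn
      hz).const_add (S₀ z.2))

/-- For every label `q`, the curves `t ↦ X(t, q)` and `t ↦ P(t, q)` solve Hamilton's equations on
`I` with the initial position `q` and the initial momentum `∇ S₀ q`. -/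
structure IsHamiltonFlow (H : ℝ × E × E → ℝ) (S₀ : E → ℝ) (I : Set ℝ) (X P : ℝ × E → E) :
    Prop where
  position_zero : ∀ q, X (0, q) = q
  momentum_zero : ∀ q, P (0, q) = ∇ S₀ q
  position_eq : ∀ z : ℝ × E, z.1 ∈ I →
    HasDerivAt (fun s => X (s, z.2)) (momentumGradient H (phasePoint X P z)) z.1
  momentum_eq : ∀ z : ℝ × E, z.1 ∈ I →
    HasDerivAt (fun s => P (s, z.2)) (-positionGradient H (phasePoint X P z)) z.1

namespace IsHamiltonFlow

theorem contDiffOn_phasePoint (h : IsHamiltonFlow H S₀ I X P) (hH : ContDiff ℝ ∞ H)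
    (hS₀ : ContDiff ℝ ∞ S₀) (hI : IsOpen I) (hIc : I.OrdConnected) (h0 : 0 ∈ I) :
    ContDiffOn ℝ ∞ (phasePoint X P) (I ×ˢ univ) := by
  have hfield : ContDiff ℝ ∞ fun w => ((1 : ℝ), momentumGradient H w, -positionGradient H w) :=
    contDiff_const.prodMk ((contDiff_momentumGradient hH).prodMk
      (contDiff_positionGradient hH).neg)
  have hcurve : ∀ q, ∀ t ∈ I, HasDerivAt (fun s => phasePoint X P (s, q))
      (1, momentumGradient H (phasePoint X P (t, q)), -positionGradient H (phasePoint X P (t, q)))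
      t := fun q t ht =>
    (hasDerivAt_id t).prodMk ((h.position_eq (t, q) ht).prodMk (h.momentum_eq (t, q) ht))
  have hinit : ContDiff ℝ ∞ fun q => phasePoint X P (0, q) := by
    simp only [phasePoint, h.position_zero, h.momentum_zero]
    exact contDiff_const.prodMk (contDiff_id.prodMk (contDiff_gradient hS₀))
  exact fun z hz => (contDiffAt_integralCurves (γ := fun t q => phasePoint X P (t, q)) hfield hI hIc
    hcurve h0 hz.1 hinit.contDiffAt).contDiffWithinAt

theorem fderiv_position_time (h : IsHamiltonFlow H S₀ I X P) (hI : IsOpen I)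
    (hX : ContDiffOn ℝ ∞ X (I ×ˢ univ)) (hz : z.1 ∈ I) :
    fderiv ℝ X z (1, 0) = momentumGradient H (phasePoint X P z) :=
  (hasDerivAt_timeSlice (hasFDerivAt_of_contDiffOn_prod_univ hI hX hz)).unique
    (h.position_eq z hz)

/-- The variation of the momentum drops out since `ẋ = H_p`. -/
theorem fderiv_lagrangian_space (h : IsHamiltonFlow H S₀ I X P) (hH : ContDiff ℝ ∞ H)
    (hI : IsOpen I) (hX : ContDiffOn ℝ ∞ X (I ×ˢ univ)) (hP : ContDiffOn ℝ ∞ P (I ×ˢ univ))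
    (hz : z.1 ∈ I) (v : E) :
    fderiv ℝ (lagrangian H X P) z (0, v) =
      inner ℝ (P z) (fderiv ℝ (fun y => fderiv ℝ X y (1, 0)) z (0, v)) -
        inner ℝ (positionGradient H (phasePoint X P z)) (fderiv ℝ X z (0, v)) := by
  have hXz := hasFDerivAt_of_contDiffOn_prod_univ hI hX hz
  have hPz := hasFDerivAt_of_contDiffOn_prod_univ hI hP hz
  have hVz := hasFDerivAt_of_contDiffOn_prod_univ hI (contDiffOn_fderiv_time hI hX) hz
  have hHz : DifferentiableAt ℝ H (phasePoint X P z) := hH.differentiable (by simp) _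
  have hsplit : ((0 : ℝ), fderiv ℝ X z (0, v), fderiv ℝ P z (0, v)) =
      (0, fderiv ℝ X z (0, v), 0) + (0, 0, fderiv ℝ P z (0, v)) := by simp
  have hℓ : fderiv ℝ (lagrangian H X P) z (0, v) =
      inner ℝ (P z) (fderiv ℝ (fun y => fderiv ℝ X y (1, 0)) z (0, v)) +
        inner ℝ (fderiv ℝ P z (0, v)) (fderiv ℝ X z (1, 0)) -
      fderiv ℝ H (phasePoint X P z) (0, fderiv ℝ X z (0, v), fderiv ℝ P z (0, v)) :=
    congrArg (· (0, v)) ((hPz.inner ℝ hVz).sub (hHz.hasFDerivAt.comp (f := phasePoint X P) z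
      (hasFDerivAt_fst.prodMk (hXz.prodMk hPz)))).fderiv
  rw [hℓ, hsplit, map_add, ← inner_positionGradient hHz, ← inner_momentumGradient hHz,
    h.fderiv_position_time hI hX hz, real_inner_comm (fderiv ℝ P z (0, v))]
  ring

theorem fderiv_action_space_zero (h : IsHamiltonFlow H S₀ I X P) (hH : ContDiff ℝ ∞ H)
    (hS₀ : ContDiff ℝ ∞ S₀) (hI : IsOpen I) (hIc : I.OrdConnected) (h0 : 0 ∈ I)
    (hX : ContDiffOn ℝ ∞ X (I ×ˢ univ)) (hP : ContDiffOn ℝ ∞ P (I ×ˢ univ)) (q v : E) :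
    fderiv ℝ (action H S₀ X P) (0, q) (0, v) =
      inner ℝ (P (0, q)) (fderiv ℝ X (0, q) (0, v)) := by
  have hs := hasFDerivAt_spaceSlice (hasFDerivAt_of_contDiffOn_prod_univ (z := (0, q)) hI
    (contDiffOn_action hH hS₀ hI hIc h0 hX hP) h0)
  have hX := hasFDerivAt_spaceSlice (hasFDerivAt_of_contDiffOn_prod_univ (z := (0, q)) hI hX h0)
  simp only [action, timePrimitive_zero_left, add_zero] at hs
  simp only [h.position_zero] at hX
  have hsv : fderiv ℝ S₀ q v = fderiv ℝ (action H S₀ X P) (0, q) (0, v) :=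
    congrArg (· v) hs.fderiv
  have hXv : v = fderiv ℝ X (0, q) (0, v) := congrArg (· v) ((hasFDerivAt_id q).unique hX)
  rw [← hsv, ← hXv, h.momentum_zero, inner_gradient_left]

/-- Both sides have the same time derivative, as `ẋ = H_p` and `ṗ = -H_x`. -/
theorem fderiv_action_space (h : IsHamiltonFlow H S₀ I X P) (hH : ContDiff ℝ ∞ H)
    (hS₀ : ContDiff ℝ ∞ S₀) (hI : IsOpen I) (hIc : I.OrdConnected) (h0 : 0 ∈ I)
    (hX : ContDiffOn ℝ ∞ X (I ×ˢ univ)) (hP : ContDiffOn ℝ ∞ P (I ×ˢ univ)) (hz : z.1 ∈ I)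
    (v : E) : fderiv ℝ (action H S₀ X P) z (0, v) = inner ℝ (P z) (fderiv ℝ X z (0, v)) := by
  obtain ⟨t, q⟩ := z
  have hs := contDiffOn_action hH hS₀ hI hIc h0 hX hP
  have htime : ∀ r ∈ I, HasDerivAt (fun r => fderiv ℝ (action H S₀ X P) (r, q) (0, v) -
      inner ℝ (P (r, q)) (fderiv ℝ X (r, q) (0, v))) 0 r := by
    intro r hr
    have hsv := hasDerivAt_fderiv_space (z := (r, q))
      ((contDiffAt_of_contDiffOn_prod_univ hI hs hr).of_le (WithTop.coe_le_coe.2 le_top)) v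
    have hXv := hasDerivAt_fderiv_space (z := (r, q))
      ((contDiffAt_of_contDiffOn_prod_univ hI hX hr).of_le (WithTop.coe_le_coe.2 le_top)) v
    have hst : (fun y => fderiv ℝ (action H S₀ X P) y (1, 0)) =ᶠ[𝓝 (r, q)] lagrangian H X P := by
      filter_upwards [continuousAt_fst.eventually (hI.mem_nhds hr)] with y hy
      exact fderiv_action_time hH hS₀ hI hIc h0 hX hP hy
    refine (hsv.sub ((h.momentum_eq (r, q) hr).inner ℝ hXv)).congr_deriv ?_
    rw [hst.fderiv_eq, h.fderiv_lagrangian_space hH hI hX hP hr, inner_neg_left]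
    ring
  have hconst := hI.is_const_of_deriv_eq_zero hIc.isPreconnected
    (fun r hr => (htime r hr).differentiableAt.differentiableWithinAt)
    (fun r hr => (htime r hr).deriv) hz h0
  exact sub_eq_zero.1 (hconst.trans (sub_eq_zero.2
    (h.fderiv_action_space_zero hH hS₀ hI hIc h0 hX hP q v)))

theorem fderiv_action (h : IsHamiltonFlow H S₀ I X P) (hH : ContDiff ℝ ∞ H)
    (hS₀ : ContDiff ℝ ∞ S₀) (hI : IsOpen I) (hIc : I.OrdConnected) (h0 : 0 ∈ I)
    (hX : ContDiffOn ℝ ∞ X (I ×ˢ univ)) (hP : ContDiffOn ℝ ∞ P (I ×ˢ univ)) (hz : z.1 ∈ I)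
    (v : ℝ × E) :
    fderiv ℝ (action H S₀ X P) z v =
      inner ℝ (P z) (fderiv ℝ X z v) - v.1 * H (phasePoint X P z) := by
  have hv : v = v.1 • ((1 : ℝ), (0 : E)) + (0, v.2) := by ext <;> simp
  rw [hv]
  simp only [map_add, map_smul, fderiv_action_time hH hS₀ hI hIc h0 hX hP hz,
    h.fderiv_action_space hH hS₀ hI hIc h0 hX hP hz, lagrangian, inner_add_right,
    inner_smul_right, smul_eq_mul]
  simp only [Prod.smul_mk, smul_eq_mul, mul_one, smul_zero, Prod.mk_add_mk, add_zero, zero_add,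
    Prod.mk.eta]
  ring

end IsHamiltonFlow

/-- The phase at `(t, y)`: the action accumulated by the particle which is at `y` at time `t`. -/
def phase (H : ℝ × E × E → ℝ) (S₀ : E → ℝ) (X P Q : ℝ × E → E) (z : ℝ × E) : ℝ :=
  action H S₀ X P (spaceTimeMap Q z)

theorem contDiffOn_phase (hXQ : IsSmoothFlow I X Q) (hH : ContDiff ℝ ∞ H) (hS₀ : ContDiff ℝ ∞ S₀)
    (hI : IsOpen I) (hIc : I.OrdConnected) (h0 : 0 ∈ I) (hP : ContDiffOn ℝ ∞ P (I ×ˢ univ)) :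
    ContDiffOn ℝ ∞ (phase H S₀ X P Q) (I ×ˢ univ) :=
  contDiffOn_comp_spaceTimeMap (g := action H S₀ X P)
    (contDiffOn_action hH hS₀ hI hIc h0 hXQ.smooth hP) hXQ.smooth_label

namespace IsHamiltonFlow

theorem label_zero (h : IsHamiltonFlow H S₀ I X P) (hXQ : IsSmoothFlow I X Q) (h0 : 0 ∈ I)
    (y : E) : Q (0, y) = y :=
  (h.position_zero _).symm.trans (hXQ.apply_label (0, y) h0)

theorem phase_zero (h : IsHamiltonFlow H S₀ I X P) (hXQ : IsSmoothFlow I X Q) (h0 : 0 ∈ I)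
    (y : E) : phase H S₀ X P Q (0, y) = S₀ y := by
  simp [phase, action, spaceTimeMap, h.label_zero hXQ h0]

theorem fderiv_phase (h : IsHamiltonFlow H S₀ I X P) (hXQ : IsSmoothFlow I X Q)
    (hH : ContDiff ℝ ∞ H) (hS₀ : ContDiff ℝ ∞ S₀) (hI : IsOpen I) (hIc : I.OrdConnected)
    (h0 : 0 ∈ I) (hP : ContDiffOn ℝ ∞ P (I ×ˢ univ)) (hz : z.1 ∈ I) (v : ℝ × E) :
    fderiv ℝ (phase H S₀ X P Q) z v = inner ℝ (P (spaceTimeMap Q z)) v.2 -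
      v.1 * H (z.1, z.2, P (spaceTimeMap Q z)) := by
  have hs := contDiffOn_action hH hS₀ hI hIc h0 hXQ.smooth hP
  have hchain := fderiv_comp_spaceTimeMap hI hs hXQ.smooth_label hz v
  rw [h.fderiv_action hH hS₀ hI hIc h0 hXQ.smooth hP (z := spaceTimeMap Q z) hz,
    hXQ.fderiv_apply_label hI hz, phasePoint, hXQ.apply_label z hz] at hchain
  exact hchain

theorem gradient_phase (h : IsHamiltonFlow H S₀ I X P) (hXQ : IsSmoothFlow I X Q)
    (hH : ContDiff ℝ ∞ H) (hS₀ : ContDiff ℝ ∞ S₀) (hI : IsOpen I) (hIc : I.OrdConnected)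
    (h0 : 0 ∈ I) (hP : ContDiffOn ℝ ∞ P (I ×ˢ univ)) (hz : z.1 ∈ I) :
    ∇ (fun y => phase H S₀ X P Q (z.1, y)) z.2 = P (spaceTimeMap Q z) := by
  refine ext_inner_right ℝ fun v => ?_
  have hS := contDiffOn_phase hXQ hH hS₀ hI hIc h0 hP
  rw [inner_gradient_left,
    (hasFDerivAt_spaceSlice (hasFDerivAt_of_contDiffOn_prod_univ hI hS hz)).fderiv]
  simpa using h.fderiv_phase hXQ hH hS₀ hI hIc h0 hP hz (0, v)

theorem hamiltonJacobi_phase (h : IsHamiltonFlow H S₀ I X P) (hXQ : IsSmoothFlow I X Q)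
    (hH : ContDiff ℝ ∞ H) (hS₀ : ContDiff ℝ ∞ S₀) (hI : IsOpen I) (hIc : I.OrdConnected)
    (h0 : 0 ∈ I) (hP : ContDiffOn ℝ ∞ P (I ×ˢ univ)) (hz : z.1 ∈ I) :
    -deriv (fun s => phase H S₀ X P Q (s, z.2)) z.1 =
      H (z.1, z.2, ∇ (fun y => phase H S₀ X P Q (z.1, y)) z.2) := by
  have hS := contDiffOn_phase hXQ hH hS₀ hI hIc h0 hP
  rw [h.gradient_phase hXQ hH hS₀ hI hIc h0 hP hz,
    (hasDerivAt_timeSlice (hasFDerivAt_of_contDiffOn_prod_univ hI hS hz)).deriv]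
  simp [h.fderiv_phase hXQ hH hS₀ hI hIc h0 hP hz]

end IsHamiltonFlow

end HamiltonFlow

section Transport

variable {E F : Type*} [NormedAddCommGroup E] [NormedSpace ℝ E] [NormedAddCommGroup F]
  [NormedSpace ℂ F] {I : Set ℝ} {X Q : ℝ × E → E} {d δ : ℝ × E → ℂ} {f : ℝ × E → F} {b₀ : E → F}
  {z : ℝ × E}

/-- Duhamel's formula for the solution of the linear equations `∂_t b + δ b = f`, with the space
variable as a parameter and the initial values `b₀`. -/
def duhamel {Y : Type*} (δ : ℝ × Y → ℂ) (f : ℝ × Y → F) (b₀ : Y → F) (z : ℝ × Y) : F :=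
  Complex.exp (-timePrimitive δ z) •
    (b₀ z.2 + timePrimitive (fun w => Complex.exp (timePrimitive δ w) • f w) z)

theorem duhamel_zero {Y : Type*} (δ : ℝ × Y → ℂ) (f : ℝ × Y → F) (b₀ : Y → F) (y : Y) :
    duhamel δ f b₀ (0, y) = b₀ y := by
  simp [duhamel]

theorem duhamel_eq_zero {Y : Type*} {δ : ℝ × Y → ℂ} {f : ℝ × Y → F} {b₀ : Y → F} {z : ℝ × Y}
    (hb₀ : b₀ z.2 = 0) (hf : ∀ r ∈ uIcc 0 z.1, f (r, z.2) = 0) : duhamel δ f b₀ z = 0 := by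
  have hsource : timePrimitive (fun w => Complex.exp (timePrimitive δ w) • f w) z =
      ∫ _ in (0 : ℝ)..z.1, (0 : F) :=
    intervalIntegral.integral_congr fun r hr => by simp [hf r hr]
  simp [duhamel, hsource, hb₀]

/-- The solution with initial values `b₀` of the transport equation along the trajectories `X`
with labels `Q`, decay rate `d` and source `f`. In the coordinates `(t, q)` given by time and
labels it is an equation `∂_t b + δ b = f`, solved by `duhamel`. -/
def transportSolution {Y : Type*} (X Q : ℝ × Y → Y) (d : ℝ × Y → ℂ) (f : ℝ × Y → F) (b₀ : Y → F)
    (z : ℝ × Y) : F :=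
  duhamel (fun w => d (spaceTimeMap X w)) (fun w => f (spaceTimeMap X w)) b₀ (spaceTimeMap Q z)

theorem transportSolution_zero {Y : Type*} {Q : ℝ × Y → Y} (hQ : ∀ y, Q (0, y) = y)
    (X : ℝ × Y → Y) (d : ℝ × Y → ℂ) (f : ℝ × Y → F) (b₀ : Y → F) (y : Y) :
    transportSolution X Q d f b₀ (0, y) = b₀ y := by
  rw [transportSolution, spaceTimeMap, hQ, duhamel_zero]

theorem transportSolution_eq_zero {Y : Type*} {X Q : ℝ × Y → Y} {d : ℝ × Y → ℂ} {f : ℝ × Y → F}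
    {b₀ : Y → F} {z : ℝ × Y} (hIc : I.OrdConnected) (h0 : 0 ∈ I) (hz : z.1 ∈ I)
    (hb₀ : b₀ (Q z) = 0) (hf : ∀ r ∈ I, f (r, X (r, Q z)) = 0) :
    transportSolution X Q d f b₀ z = 0 :=
  duhamel_eq_zero hb₀ fun r hr => hf r (hIc.uIcc_subset h0 hz hr)

variable [CompleteSpace F]

theorem hasDerivAt_duhamel {Y : Type*} [TopologicalSpace Y] {δ : ℝ × Y → ℂ} {f : ℝ × Y → F}
    {b₀ : Y → F} {z : ℝ × Y} (hI : IsOpen I) (hIc : I.OrdConnected) (h0 : 0 ∈ I)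
    (hδ : ContinuousOn δ (I ×ˢ univ)) (hf : ContinuousOn f (I ×ˢ univ))
    (hexp : ContinuousOn (timePrimitive δ) (I ×ˢ univ)) (hz : z.1 ∈ I) :
    HasDerivAt (fun s => duhamel δ f b₀ (s, z.2)) (f z - δ z • duhamel δ f b₀ z) z.1 := by
  have hB := hasDerivAt_timePrimitive hI hIc h0 hδ hz
  have hsource := hasDerivAt_timePrimitive (g := fun w => Complex.exp (timePrimitive δ w) • f w)
    hI hIc h0 (hexp.cexp.smul hf) hz
  refine (hB.fun_neg.cexp.smul (hsource.const_add (b₀ z.2))).congr_deriv ?_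
  rw [smul_smul, ← Complex.exp_add, neg_add_cancel, Complex.exp_zero, one_smul, mul_neg, neg_smul,
    mul_comm, mul_smul, ← sub_eq_add_neg, duhamel]

variable [CompleteSpace E]

theorem contDiffOn_duhamel (hI : IsOpen I) (hIc : I.OrdConnected) (h0 : 0 ∈ I)
    (hδ : ContDiffOn ℝ ∞ δ (I ×ˢ univ)) (hf : ContDiffOn ℝ ∞ f (I ×ˢ univ))
    (hb₀ : ContDiff ℝ ∞ b₀) : ContDiffOn ℝ ∞ (duhamel δ f b₀) (I ×ˢ univ) := by
  have hB := contDiffOn_timePrimitive hI hIc h0 hδ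
  exact hB.neg.cexp.smul ((hb₀.comp contDiff_snd).contDiffOn.add
    (contDiffOn_timePrimitive hI hIc h0 (hB.cexp.smul hf)))

theorem contDiffOn_transportSolution (h : IsSmoothFlow I X Q) (hI : IsOpen I) (hIc : I.OrdConnected)
    (h0 : 0 ∈ I) (hd : ContDiffOn ℝ ∞ d (I ×ˢ univ)) (hf : ContDiffOn ℝ ∞ f (I ×ˢ univ))
    (hb₀ : ContDiff ℝ ∞ b₀) :
    ContDiffOn ℝ ∞ (transportSolution X Q d f b₀) (I ×ˢ univ) :=
  (contDiffOn_duhamel hI hIc h0 (contDiffOn_comp_spaceTimeMap hd h.smooth)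
    (contDiffOn_comp_spaceTimeMap hf h.smooth) hb₀).comp
    (contDiffOn_spaceTimeMap h.smooth_label) (mapsTo_spaceTimeMap I Q)

theorem fderiv_transportSolution (h : IsSmoothFlow I X Q) (hI : IsOpen I) (hIc : I.OrdConnected)
    (h0 : 0 ∈ I) (hd : ContDiffOn ℝ ∞ d (I ×ˢ univ)) (hf : ContDiffOn ℝ ∞ f (I ×ˢ univ))
    (hb₀ : ContDiff ℝ ∞ b₀) (hz : z.1 ∈ I) :
    fderiv ℝ (transportSolution X Q d f b₀) z (1, fderiv ℝ X (spaceTimeMap Q z) (1, 0)) =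
      f z - d z • transportSolution X Q d f b₀ z := by
  have hdX := contDiffOn_comp_spaceTimeMap hd h.smooth
  have hfX := contDiffOn_comp_spaceTimeMap hf h.smooth
  have hb := contDiffOn_duhamel hI hIc h0 hdX hfX hb₀
  have hlabel : (fun w => transportSolution X Q d f b₀ (spaceTimeMap X w)) =ᶠ[𝓝 (spaceTimeMap Q z)]
      duhamel (fun w => d (spaceTimeMap X w)) (fun w => f (spaceTimeMap X w)) b₀ := by
    filter_upwards [continuousAt_fst.eventually (hI.mem_nhds (x := (spaceTimeMap Q z).1) hz)]
      with w hw
    rw [transportSolution, h.symm.spaceTimeMap_label hw]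
  have hchain := fderiv_comp_spaceTimeMap (z := spaceTimeMap Q z) hI
    (contDiffOn_transportSolution h hI hIc h0 hd hf hb₀) h.smooth hz (1, 0)
  have htime := (hasDerivAt_timeSlice (hasFDerivAt_of_contDiffOn_prod_univ (z := spaceTimeMap Q z)
    hI hb hz)).unique (hasDerivAt_duhamel hI hIc h0 hdX.continuousOn hfX.continuousOn
      (contDiffOn_timePrimitive hI hIc h0 hdX).continuousOn hz)
  rw [hlabel.fderiv_eq, htime, h.spaceTimeMap_label hz] at hchain
  exact hchain.symm

end Transport

section Derivatives

variable {ψ χ : SpaceTime → ℂ} {z : SpaceTime} {j : Fin 3} {m n : ℕ∞ω}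

theorem spaceDeriv_eq_fderiv (hψ : DifferentiableAt ℝ ψ z) :
    spaceDeriv j ψ z = fderiv ℝ ψ z (0, EuclideanSpace.single j 1) :=
  DFunLike.congr_fun (hasFDerivAt_spaceSlice hψ.hasFDerivAt).fderiv _

theorem timeDeriv_eq_fderiv (hψ : DifferentiableAt ℝ ψ z) :
    timeDeriv ψ z = fderiv ℝ ψ z (1, 0) :=
  (hasDerivAt_timeSlice hψ.hasFDerivAt).deriv

theorem fderiv_eq_timeDeriv_add (hψ : DifferentiableAt ℝ ψ z) (v : Space) :
    fderiv ℝ ψ z (1, v) = timeDeriv ψ z + ∑ j, v j * spaceDeriv j ψ z := by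
  have hv : ((1 : ℝ), v) = (1, 0) + ∑ j, v j • ((0 : ℝ), EuclideanSpace.single j (1 : ℝ)) := by
    refine Prod.ext (by simp [Prod.fst_sum]) ?_
    simpa [Prod.snd_sum] using ((EuclideanSpace.basisFun (Fin 3) ℝ).sum_repr v).symm
  rw [hv, map_add, map_sum, timeDeriv_eq_fderiv hψ]
  simp only [map_smul, Complex.real_smul, spaceDeriv_eq_fderiv hψ]

theorem spaceDeriv_congr (h : ψ =ᶠ[𝓝 z] χ) : spaceDeriv j ψ z = spaceDeriv j χ z := by
  have hslice : (fun y => ψ (z.1, y)) =ᶠ[𝓝 z.2] fun y => χ (z.1, y) :=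
    (Continuous.prodMk_right z.1).continuousAt.eventually h
  rw [spaceDeriv, spaceDeriv, hslice.fderiv_eq]

theorem spaceDeriv_const_mul (r : ℂ) :
    spaceDeriv j (fun w => r * ψ w) z = r * spaceDeriv j ψ z :=
  DFunLike.congr_fun (congrFun (fderiv_const_smul_field (f := fun y => ψ (z.1, y)) r) z.2) _

theorem timeDeriv_const_mul (r : ℂ) : timeDeriv (fun w => r * ψ w) z = r * timeDeriv ψ z :=
  deriv_const_mul_field r

theorem spaceDeriv_add (hψ : DifferentiableAt ℝ ψ z) (hχ : DifferentiableAt ℝ χ z) :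
    spaceDeriv j (fun w => ψ w + χ w) z = spaceDeriv j ψ z + spaceDeriv j χ z := by
  simp [spaceDeriv_eq_fderiv, hψ, hχ, hψ.fun_add hχ, fderiv_fun_add]

theorem timeDeriv_add (hψ : DifferentiableAt ℝ ψ z) (hχ : DifferentiableAt ℝ χ z) :
    timeDeriv (fun w => ψ w + χ w) z = timeDeriv ψ z + timeDeriv χ z := by
  simp [timeDeriv_eq_fderiv, hψ, hχ, hψ.fun_add hχ, fderiv_fun_add]

theorem spaceDeriv_mul (hψ : DifferentiableAt ℝ ψ z) (hχ : DifferentiableAt ℝ χ z) :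
    spaceDeriv j (fun w => ψ w * χ w) z = ψ z * spaceDeriv j χ z + χ z * spaceDeriv j ψ z := by
  simp [spaceDeriv_eq_fderiv, hψ, hχ, hψ.fun_mul hχ, fderiv_fun_mul]

theorem timeDeriv_mul (hψ : DifferentiableAt ℝ ψ z) (hχ : DifferentiableAt ℝ χ z) :
    timeDeriv (fun w => ψ w * χ w) z = ψ z * timeDeriv χ z + χ z * timeDeriv ψ z := by
  simp [timeDeriv_eq_fderiv, hψ, hχ, hψ.fun_mul hχ, fderiv_fun_mul]

theorem contDiffAt_spaceDeriv (hψ : ContDiffAt ℝ n ψ z) (hmn : m + 1 ≤ n) :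
    ContDiffAt ℝ m (spaceDeriv j ψ) z := by
  refine ((hψ.fderiv_right hmn).clm_apply (contDiffAt_const
    (c := ((0 : ℝ), EuclideanSpace.single j (1 : ℝ))))).congr_of_eventuallyEq ?_
  filter_upwards [(hψ.of_le (le_add_self.trans hmn)).eventually (by simp)] with w hw
  exact spaceDeriv_eq_fderiv (hw.differentiableAt (by simp))

theorem gradient_spaceSlice_apply {S : SpaceTime → ℝ} (hS : DifferentiableAt ℝ S z) (j : Fin 3) :
    ∇ (fun y => S (z.1, y)) z.2 j = fderiv ℝ S z (0, EuclideanSpace.single j 1) := by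
  rw [← EuclideanSpace.basisFun_inner, real_inner_comm, inner_gradient_left,
    (hasFDerivAt_spaceSlice hS.hasFDerivAt).fderiv, EuclideanSpace.basisFun_apply]
  simp

theorem spaceDeriv_ofReal {S : SpaceTime → ℝ} (hS : DifferentiableAt ℝ S z) :
    spaceDeriv j (fun w => (S w : ℂ)) z = (∇ (fun y => S (z.1, y)) z.2 j : ℝ) := by
  have hSc : HasFDerivAt (fun w => (S w : ℂ)) (Complex.ofRealCLM ∘L fderiv ℝ S z) z :=
    Complex.ofRealCLM.hasFDerivAt.comp z hS.hasFDerivAt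
  rw [spaceDeriv_eq_fderiv hSc.differentiableAt, hSc.fderiv, gradient_spaceSlice_apply hS]
  simp

/-- The spatial Laplacian of a function on space-time. -/
def spaceLaplacian (ψ : SpaceTime → ℂ) (z : SpaceTime) : ℂ :=
  ∑ j : Fin 3, spaceDeriv j (spaceDeriv j ψ) z

theorem spaceLaplacian_eq_zero (h : ψ =ᶠ[𝓝 z] 0) : spaceLaplacian ψ z = 0 := by
  have hderiv : ∀ j, spaceDeriv j ψ =ᶠ[𝓝 z] 0 := fun j => by
    filter_upwards [h.eventually_nhds] with w hw
    simpa [spaceDeriv] using spaceDeriv_congr (j := j) hw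
  refine Finset.sum_eq_zero fun j _ => ?_
  simpa [spaceDeriv] using spaceDeriv_congr (j := j) (hderiv j)

theorem contDiffAt_spaceLaplacian (hψ : ContDiffAt ℝ ∞ ψ z) :
    ContDiffAt ℝ ∞ (spaceLaplacian ψ) z :=
  ContDiffAt.sum fun _ _ => contDiffAt_spaceDeriv (contDiffAt_spaceDeriv hψ le_rfl) le_rfl

end Derivatives

section Wave

variable {S : SpaceTime → ℝ} {z : SpaceTime} {n : ℕ∞ω}

/-- The oscillating factor `e^{iS/h}`. -/
def wave (S : SpaceTime → ℝ) (h : ℝ) (z : SpaceTime) : ℂ := Complex.exp (Complex.I * S z / h)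

theorem norm_wave (S : SpaceTime → ℝ) (h : ℝ) (z : SpaceTime) : ‖wave S h z‖ = 1 := by
  rw [wave, ← Complex.norm_exp_ofReal_mul_I (S z / h)]
  push_cast
  ring_nf

theorem contDiffAt_wave (hS : ContDiffAt ℝ n S z) (h : ℝ) : ContDiffAt ℝ n (wave S h) z :=
  ((contDiffAt_const.mul (Complex.ofRealCLM.contDiff.contDiffAt.comp z hS)).div_const _).cexp

theorem differentiableAt_wave (hS : DifferentiableAt ℝ S z) (h : ℝ) :
    DifferentiableAt ℝ (wave S h) z :=
  (((Complex.ofRealCLM.differentiableAt.comp z hS).const_mul _).mul_const _).cexp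

theorem fderiv_wave (hS : DifferentiableAt ℝ S z) (h : ℝ) (v : SpaceTime) :
    fderiv ℝ (wave S h) z v = Complex.I * fderiv ℝ S z v / h * wave S h z := by
  have hSc : HasFDerivAt (fun w => (S w : ℂ)) (Complex.ofRealCLM ∘L fderiv ℝ S z) z :=
    Complex.ofRealCLM.hasFDerivAt.comp z hS.hasFDerivAt
  have hwave : HasFDerivAt (wave S h) _ z := ((hSc.const_mul Complex.I).mul_const (h : ℂ)⁻¹).cexp
  rw [hwave.fderiv]
  simp only [smul_apply, ContinuousLinearMap.comp_apply, Complex.ofRealCLM_apply, smul_eq_mul,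
    div_eq_mul_inv, wave]
  ring

end Wave

section Schrodinger

variable {e c μ h : ℝ} {φ : SpaceTime → ℝ} {A : SpaceTime → Space} {S : SpaceTime → ℝ}
  {a ψ χ : SpaceTime → ℂ} {z : SpaceTime} {j : Fin 3} {m n : ℕ∞ω}

theorem momentum_congr (hψ : ψ =ᶠ[𝓝 z] χ) : momentum e c h A j ψ z = momentum e c h A j χ z := by
  rw [momentum, momentum, spaceDeriv_congr hψ, hψ.eq_of_nhds]

theorem momentum_const_mul (r : ℂ) :
    momentum e c h A j (fun w => r * ψ w) = fun w => r * momentum e c h A j ψ w := by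
  funext z
  rw [momentum, momentum, spaceDeriv_const_mul]
  ring

theorem momentum_add (hψ : DifferentiableAt ℝ ψ z) (hχ : DifferentiableAt ℝ χ z) :
    momentum e c h A j (fun w => ψ w + χ w) z
      = momentum e c h A j ψ z + momentum e c h A j χ z := by
  rw [momentum, momentum, momentum, spaceDeriv_add hψ hχ]
  ring

theorem contDiffAt_momentum (hA : ContDiffAt ℝ m A z) (hψ : ContDiffAt ℝ n ψ z)
    (hmn : m + 1 ≤ n) : ContDiffAt ℝ m (momentum e c h A j ψ) z :=
  (contDiffAt_const.mul (contDiffAt_spaceDeriv hψ hmn)).sub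
    ((Complex.ofRealCLM.contDiff.contDiffAt.comp z
      (contDiffAt_const.mul (contDiffAt_euclidean.1 hA j))).mul
        (hψ.of_le (le_self_add.trans hmn)))

theorem schrodinger_const_mul (r : ℂ) :
    schrodinger e c μ h φ A (fun w => r * ψ w) z = r * schrodinger e c μ h φ A ψ z := by
  simp only [schrodinger, timeDeriv_const_mul, momentum_const_mul, ← Finset.mul_sum]
  ring

theorem schrodinger_add (hA : ContDiffAt ℝ 1 A z) (hψ : ContDiffAt ℝ 2 ψ z)
    (hχ : ContDiffAt ℝ 2 χ z) :
    schrodinger e c μ h φ A (fun w => ψ w + χ w) z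
      = schrodinger e c μ h φ A ψ z + schrodinger e c μ h φ A χ z := by
  have hsecond : ∀ j, momentum e c h A j (momentum e c h A j fun w => ψ w + χ w) z
      = momentum e c h A j (momentum e c h A j ψ) z
        + momentum e c h A j (momentum e c h A j χ) z := fun j => by
    have hfirst : momentum e c h A j (fun w => ψ w + χ w) =ᶠ[𝓝 z]
        fun w => momentum e c h A j ψ w + momentum e c h A j χ w := by
      filter_upwards [hψ.eventually (by simp), hχ.eventually (by simp)] with w hψw hχw
      exact momentum_add (hψw.differentiableAt (by simp)) (hχw.differentiableAt (by simp))
    rw [momentum_congr hfirst]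
    exact momentum_add
      ((contDiffAt_momentum hA hψ one_add_one_eq_two.le).differentiableAt (by simp))
      ((contDiffAt_momentum hA hχ one_add_one_eq_two.le).differentiableAt (by simp))
  rw [schrodinger, timeDeriv_add (hψ.differentiableAt (by simp)) (hχ.differentiableAt (by simp))]
  simp only [hsecond, Finset.sum_add_distrib, schrodinger]
  ring

/-- The kinetic momentum `∇S - (e/c) A` of the particles described by the phase `S`. -/
def kineticMomentum (e c : ℝ) (A : SpaceTime → Space) (S : SpaceTime → ℝ) (z : SpaceTime) :
    Space :=
  ∇ (fun y => S (z.1, y)) z.2 - (e / c) • A z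

theorem contDiffAt_kineticMomentum (hA : ContDiffAt ℝ m A z) (hS : ContDiffAt ℝ n S z)
    (hmn : m + 1 ≤ n) (j : Fin 3) :
    ContDiffAt ℝ m (fun w => (kineticMomentum e c A S w j : ℂ)) z := by
  have hSc : ContDiffAt ℝ n (fun w => (S w : ℂ)) z :=
    Complex.ofRealCLM.contDiff.contDiffAt.comp z hS
  have hAj : ContDiffAt ℝ m (fun w => ((e / c * A w j : ℝ) : ℂ)) z :=
    Complex.ofRealCLM.contDiff.contDiffAt.comp z
      (contDiffAt_const.mul (contDiffAt_euclidean.1 hA j))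
  refine ((contDiffAt_spaceDeriv (j := j) hSc hmn).sub hAj).congr_of_eventuallyEq ?_
  filter_upwards [(hS.of_le (le_add_self.trans hmn)).eventually (by simp)] with w hw
  rw [spaceDeriv_ofReal (hw.differentiableAt (by simp)), kineticMomentum]
  simp

/-- The operator on amplitudes obtained by conjugating the momentum operator with `e^{iS/h}`. -/
def conjugatedMomentum (e c h : ℝ) (A : SpaceTime → Space) (S : SpaceTime → ℝ) (j : Fin 3)
    (a : SpaceTime → ℂ) (z : SpaceTime) : ℂ :=
  -Complex.I * h * spaceDeriv j a z + kineticMomentum e c A S z j * a z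

theorem momentum_mul_wave (hh : h ≠ 0) (hS : DifferentiableAt ℝ S z)
    (ha : DifferentiableAt ℝ a z) :
    momentum e c h A j (fun w => a w * wave S h w) z
      = conjugatedMomentum e c h A S j a z * wave S h z := by
  have hhC : (h : ℂ) ≠ 0 := Complex.ofReal_ne_zero.2 hh
  have hwave := differentiableAt_wave hS h
  rw [momentum, spaceDeriv_mul ha hwave, spaceDeriv_eq_fderiv hwave, fderiv_wave hS,
    ← gradient_spaceSlice_apply hS, conjugatedMomentum, kineticMomentum]
  simp only [PiLp.sub_apply, PiLp.smul_apply, smul_eq_mul]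
  push_cast
  field_simp
  linear_combination (-(∇ (fun y => S (z.1, y)) z.2 j : ℂ) * a z * wave S h z) * Complex.I_sq

theorem contDiffAt_conjugatedMomentum (hA : ContDiffAt ℝ m A z) (hS : ContDiffAt ℝ n S z)
    (ha : ContDiffAt ℝ n a z) (hmn : m + 1 ≤ n) :
    ContDiffAt ℝ m (conjugatedMomentum e c h A S j a) z :=
  (contDiffAt_const.mul (contDiffAt_spaceDeriv ha hmn)).add
    ((contDiffAt_kineticMomentum hA hS hmn j).mul (ha.of_le (le_self_add.trans hmn)))

theorem conjugatedMomentum_conjugatedMomentum (hA : ContDiffAt ℝ 1 A z) (hS : ContDiffAt ℝ 2 S z)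
    (ha : ContDiffAt ℝ 2 a z) :
    conjugatedMomentum e c h A S j (conjugatedMomentum e c h A S j a) z
      = -(h : ℂ) ^ 2 * spaceDeriv j (spaceDeriv j a) z
        - Complex.I * h * (2 * (kineticMomentum e c A S z j * spaceDeriv j a z)
            + spaceDeriv j (fun w => (kineticMomentum e c A S w j : ℂ)) z * a z)
        + kineticMomentum e c A S z j ^ 2 * a z := by
  have ha₁ := (contDiffAt_spaceDeriv (j := j) ha one_add_one_eq_two.le).differentiableAt (by simp)
  have hK := (contDiffAt_kineticMomentum (e := e) (c := c) hA hS one_add_one_eq_two.le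
    j).differentiableAt (by simp)
  have ha₀ := ha.differentiableAt (by simp)
  have hderiv : spaceDeriv j (conjugatedMomentum e c h A S j a) z
      = -Complex.I * h * spaceDeriv j (spaceDeriv j a) z
        + (kineticMomentum e c A S z j * spaceDeriv j a z
          + a z * spaceDeriv j (fun w => (kineticMomentum e c A S w j : ℂ)) z) := by
    rw [← spaceDeriv_mul hK ha₀, ← spaceDeriv_const_mul]
    exact spaceDeriv_add (ha₁.const_mul _) (hK.fun_mul ha₀)
  rw [conjugatedMomentum, hderiv, conjugatedMomentum]
  linear_combination ((h : ℂ) ^ 2 * spaceDeriv j (spaceDeriv j a) z) * Complex.I_sq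

theorem momentum_momentum_mul_wave (hh : h ≠ 0) (hA : ContDiffAt ℝ 1 A z)
    (hS : ContDiffAt ℝ 2 S z) (ha : ContDiffAt ℝ 2 a z) :
    momentum e c h A j (momentum e c h A j (fun w => a w * wave S h w)) z
      = conjugatedMomentum e c h A S j (conjugatedMomentum e c h A S j a) z * wave S h z := by
  have hfirst : momentum e c h A j (fun w => a w * wave S h w) =ᶠ[𝓝 z]
      fun w => conjugatedMomentum e c h A S j a w * wave S h w := by
    filter_upwards [hS.eventually (by simp), ha.eventually (by simp)] with w hSw haw
    exact momentum_mul_wave hh (hSw.differentiableAt (by simp)) (haw.differentiableAt (by simp))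
  rw [momentum_congr hfirst]
  exact momentum_mul_wave hh (hS.differentiableAt (by simp))
    ((contDiffAt_conjugatedMomentum hA hS ha one_add_one_eq_two.le).differentiableAt (by simp))

/-- Half the divergence of the velocity field `(∇S - (e/c) A)/μ`: the rate at which amplitudes
decay along the rays. -/
def amplitudeDecay (e c μ : ℝ) (A : SpaceTime → Space) (S : SpaceTime → ℝ) (z : SpaceTime) : ℂ :=
  ((1 / (2 * μ) : ℝ) : ℂ) *
    ∑ j : Fin 3, spaceDeriv j (fun w => (kineticMomentum e c A S w j : ℂ)) z

theorem contDiffAt_amplitudeDecay (hA : ContDiffAt ℝ ∞ A z) (hS : ContDiffAt ℝ ∞ S z) :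
    ContDiffAt ℝ ∞ (amplitudeDecay e c μ A S) z :=
  contDiffAt_const.mul (ContDiffAt.sum fun j _ =>
    contDiffAt_spaceDeriv (contDiffAt_kineticMomentum hA hS le_rfl j) le_rfl)

/-- The transport operator: differentiation along the rays, corrected by `amplitudeDecay`. -/
def transport (e c μ : ℝ) (A : SpaceTime → Space) (S : SpaceTime → ℝ) (a : SpaceTime → ℂ)
    (z : SpaceTime) : ℂ :=
  fderiv ℝ a z (1, (1 / μ) • kineticMomentum e c A S z) + amplitudeDecay e c μ A S z * a z

theorem transport_eq_timeDeriv_add (ha : DifferentiableAt ℝ a z) :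
    transport e c μ A S a z = timeDeriv a z + ((1 / (2 * μ) : ℝ) : ℂ) *
      (2 * ∑ j, kineticMomentum e c A S z j * spaceDeriv j a z
        + (∑ j, spaceDeriv j (fun w => (kineticMomentum e c A S w j : ℂ)) z) * a z) := by
  simp only [transport, amplitudeDecay, fderiv_eq_timeDeriv_add ha, PiLp.smul_apply, smul_eq_mul,
    Complex.ofReal_mul, mul_assoc, ← Finset.mul_sum]
  push_cast
  ring

theorem timeDeriv_mul_wave (hS : DifferentiableAt ℝ S z) (ha : DifferentiableAt ℝ a z) :
    timeDeriv (fun w => a w * wave S h w) z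
      = (timeDeriv a z + Complex.I * (deriv (fun s => S (s, z.2)) z.1 : ℝ) / h * a z)
        * wave S h z := by
  have hwave := differentiableAt_wave hS h
  rw [timeDeriv_mul ha hwave, timeDeriv_eq_fderiv hwave, fderiv_wave hS,
    (hasDerivAt_timeSlice hS.hasFDerivAt).deriv]
  ring

theorem schrodinger_mul_wave (hh : h ≠ 0) (hA : ContDiffAt ℝ 1 A z) (hS : ContDiffAt ℝ 2 S z)
    (ha : ContDiffAt ℝ 2 a z)
    (hHJ : -deriv (fun s => S (s, z.2)) z.1
      = hamiltonian e c μ φ A z.2 (∇ (fun y => S (z.1, y)) z.2) z.1) :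
    schrodinger e c μ h φ A (fun w => a w * wave S h w) z
      = (Complex.I * h * transport e c μ A S a z
        + ((1 / (2 * μ) : ℝ) : ℂ) * h ^ 2 * spaceLaplacian a z) * wave S h z := by
  have hhC : (h : ℂ) ≠ 0 := Complex.ofReal_ne_zero.2 hh
  have ha₀ := ha.differentiableAt (by simp)
  have hSt : ((deriv (fun s => S (s, z.2)) z.1 : ℝ) : ℂ) = -((e * φ z : ℝ) : ℂ)
      - ((1 / (2 * μ) : ℝ) : ℂ) * ∑ j, (kineticMomentum e c A S z j : ℂ) ^ 2 := by
    have hnorm : ‖kineticMomentum e c A S z‖ ^ 2 = ∑ j, kineticMomentum e c A S z j ^ 2 :=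
      EuclideanSpace.real_norm_sq_eq _
    rw [neg_eq_iff_eq_neg.1 hHJ, hamiltonian, ← kineticMomentum, hnorm]
    push_cast
    ring
  rw [schrodinger, timeDeriv_mul_wave (hS.differentiableAt (by simp)) ha₀, hSt,
    transport_eq_timeDeriv_add ha₀, spaceLaplacian]
  simp only [momentum_momentum_mul_wave hh hA hS ha,
    conjugatedMomentum_conjugatedMomentum hA hS ha, ← Finset.sum_mul, Finset.sum_add_distrib,
    Finset.sum_sub_distrib, ← Finset.mul_sum]
  generalize ∑ j, (kineticMomentum e c A S z j : ℂ) ^ 2 = q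
  generalize ((1 / (2 * μ) : ℝ) : ℂ) = m
  field_simp
  linear_combination (-(((e * φ z : ℝ) : ℂ) + m * q) * a z * wave S h z) * Complex.I_sq

theorem debyeSum_zero (S : SpaceTime → ℝ) (a : ℕ → SpaceTime → ℂ) (h : ℝ) :
    debyeSum S a h 0 = fun w => a 0 w * wave S h w := by
  funext w
  simp [debyeSum, wave]

theorem debyeSum_succ (S : SpaceTime → ℝ) (a : ℕ → SpaceTime → ℂ) (h : ℝ) (N : ℕ) :
    debyeSum S a h (N + 1)
      = fun w => debyeSum S a h N w + h ^ (N + 1) * (a (N + 1) w * wave S h w) := by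
  funext w
  rw [debyeSum, Finset.sum_range_succ, add_mul, mul_assoc]
  rfl

theorem contDiffAt_debyeSum {a : ℕ → SpaceTime → ℂ} (hS : ContDiffAt ℝ n S z)
    (ha : ∀ k, ContDiffAt ℝ n (a k) z) (N : ℕ) : ContDiffAt ℝ n (debyeSum S a h N) z :=
  (ContDiffAt.sum fun k _ => contDiffAt_const.mul (ha k)).mul (contDiffAt_wave hS h)

theorem schrodinger_debyeSum {a : ℕ → SpaceTime → ℂ} (hh : h ≠ 0) (hA : ContDiffAt ℝ 1 A z)
    (hS : ContDiffAt ℝ 2 S z) (ha : ∀ k, ContDiffAt ℝ 2 (a k) z)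
    (hHJ : -deriv (fun s => S (s, z.2)) z.1
      = hamiltonian e c μ φ A z.2 (∇ (fun y => S (z.1, y)) z.2) z.1)
    (hzero : transport e c μ A S (a 0) z = 0)
    (hsucc : ∀ k, transport e c μ A S (a (k + 1)) z
      = Complex.I * ((1 / (2 * μ) : ℝ) : ℂ) * spaceLaplacian (a k) z) (N : ℕ) :
    schrodinger e c μ h φ A (debyeSum S a h N) z
      = ((1 / (2 * μ) : ℝ) : ℂ) * h ^ (N + 2) * spaceLaplacian (a N) z * wave S h z := by
  induction N with
  | zero =>
    rw [debyeSum_zero, schrodinger_mul_wave hh hA hS (ha 0) hHJ, hzero]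
    ring
  | succ N ih =>
    rw [debyeSum_succ, schrodinger_add hA (contDiffAt_debyeSum hS ha N)
      (contDiffAt_const.mul ((ha (N + 1)).mul (contDiffAt_wave hS h))), ih, schrodinger_const_mul,
      schrodinger_mul_wave hh hA hS (ha (N + 1)) hHJ, hsucc]
    linear_combination (h ^ (N + 2) * ((1 / (2 * μ) : ℝ) : ℂ) * spaceLaplacian (a N) z
      * wave S h z) * Complex.I_sq

end Schrodinger

section Amplitudes

/-- The amplitudes obtained by solving successively the transport equations along the trajectories
`X` with labels `Q` and decay rate `d`, each with `m` times the Laplacian of its predecessor as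
source. -/
def amplitude (X Q : SpaceTime → Space) (d : SpaceTime → ℂ) (m : ℂ) (a₀ : Space → ℂ) :
    ℕ → SpaceTime → ℂ
  | 0 => transportSolution X Q d (fun _ => 0) a₀
  | k + 1 => transportSolution X Q d
      (fun z => m * spaceLaplacian (amplitude X Q d m a₀ k) z) fun _ => 0

variable {I : Set ℝ} {X Q : SpaceTime → Space} {d : SpaceTime → ℂ} {m : ℂ} {a₀ : Space → ℂ}
  {z : SpaceTime}

theorem contDiffOn_spaceLaplacian {ψ : SpaceTime → ℂ} (hI : IsOpen I)
    (hψ : ContDiffOn ℝ ∞ ψ (I ×ˢ univ)) : ContDiffOn ℝ ∞ (spaceLaplacian ψ) (I ×ˢ univ) :=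
  fun _ hz => (contDiffAt_spaceLaplacian
    (contDiffAt_of_contDiffOn_prod_univ hI hψ hz.1)).contDiffWithinAt

theorem contDiffOn_amplitude (h : IsSmoothFlow I X Q) (hI : IsOpen I) (hIc : I.OrdConnected)
    (h0 : 0 ∈ I) (hd : ContDiffOn ℝ ∞ d (I ×ˢ univ)) (ha₀ : ContDiff ℝ ∞ a₀) :
    ∀ k, ContDiffOn ℝ ∞ (amplitude X Q d m a₀ k) (I ×ˢ univ)
  | 0 => contDiffOn_transportSolution h hI hIc h0 hd contDiffOn_const ha₀
  | k + 1 => contDiffOn_transportSolution h hI hIc h0 hd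
      (contDiffOn_const.mul (contDiffOn_spaceLaplacian hI
        (contDiffOn_amplitude h hI hIc h0 hd ha₀ k))) contDiff_const

theorem fderiv_amplitude_zero (h : IsSmoothFlow I X Q) (hI : IsOpen I) (hIc : I.OrdConnected)
    (h0 : 0 ∈ I) (hd : ContDiffOn ℝ ∞ d (I ×ˢ univ)) (ha₀ : ContDiff ℝ ∞ a₀) (hz : z.1 ∈ I) :
    fderiv ℝ (amplitude X Q d m a₀ 0) z (1, fderiv ℝ X (spaceTimeMap Q z) (1, 0))
      + d z * amplitude X Q d m a₀ 0 z = 0 := by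
  rw [amplitude, fderiv_transportSolution h hI hIc h0 hd contDiffOn_const ha₀ hz, smul_eq_mul,
    sub_add_cancel]

theorem fderiv_amplitude_succ (h : IsSmoothFlow I X Q) (hI : IsOpen I) (hIc : I.OrdConnected)
    (h0 : 0 ∈ I) (hd : ContDiffOn ℝ ∞ d (I ×ˢ univ)) (ha₀ : ContDiff ℝ ∞ a₀) (k : ℕ)
    (hz : z.1 ∈ I) :
    fderiv ℝ (amplitude X Q d m a₀ (k + 1)) z (1, fderiv ℝ X (spaceTimeMap Q z) (1, 0))
      + d z * amplitude X Q d m a₀ (k + 1) z = m * spaceLaplacian (amplitude X Q d m a₀ k) z := by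
  rw [amplitude, fderiv_transportSolution h hI hIc h0 hd (contDiffOn_const.mul
    (contDiffOn_spaceLaplacian hI (contDiffOn_amplitude h hI hIc h0 hd ha₀ k))) contDiff_const hz,
    smul_eq_mul, sub_add_cancel]

theorem amplitude_eq_zero (h : IsSmoothFlow I X Q) (hI : IsOpen I) (hIc : I.OrdConnected)
    (h0 : 0 ∈ I) (hz : z.1 ∈ I) (hQ : Q z ∉ tsupport a₀) (k : ℕ) :
    amplitude X Q d m a₀ k z = 0 := by
  induction k generalizing z with
  | zero =>
    exact transportSolution_eq_zero hIc h0 hz (image_eq_zero_of_notMem_tsupport hQ) fun _ _ => rfl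
  | succ k ih =>
    refine transportSolution_eq_zero hIc h0 hz rfl fun r hr => ?_
    have hlabel : Q (r, X (r, Q z)) ∉ tsupport a₀ := by
      rwa [show Q (r, X (r, Q z)) = Q z from h.label_apply (r, Q z) hr]
    have hcont : ContinuousAt Q (r, X (r, Q z)) :=
      (contDiffAt_of_contDiffOn_prod_univ hI h.smooth_label hr).continuousAt
    have hvanish : amplitude X Q d m a₀ k =ᶠ[𝓝 (r, X (r, Q z))] 0 := by
      filter_upwards [hcont.eventually ((isClosed_tsupport a₀).isOpen_compl.mem_nhds hlabel),
        continuousAt_fst.eventually (hI.mem_nhds hr)] with w hQw hw using ih hw hQw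
    rw [spaceLaplacian_eq_zero hvanish, mul_zero]

end Amplitudes

section MaxwellField

/-- The Hamiltonian as a function of the point `(t, x, p)` of extended phase space. -/
def phaseSpaceHamiltonian (e c μ : ℝ) (φ : SpaceTime → ℝ) (A : SpaceTime → Space)
    (w : ℝ × Space × Space) : ℝ :=
  hamiltonian e c μ φ A w.2.1 w.2.2 w.1

variable {e c μ T : ℝ} {φ : SpaceTime → ℝ} {A : SpaceTime → Space} {S₀ : Space → ℝ}
  {a₀ : Space → ℂ} {x p : ℝ → Space → Space} {X P Q : SpaceTime → Space} {z : SpaceTime}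

theorem contDiff_phaseSpaceHamiltonian (hφ : ContDiff ℝ ∞ φ) (hA : ContDiff ℝ ∞ A) :
    ContDiff ℝ ∞ (phaseSpaceHamiltonian e c μ φ A) := by
  have hproj : ContDiff ℝ ∞ fun w : ℝ × Space × Space => ((w.1, w.2.1) : SpaceTime) := by fun_prop
  exact (contDiff_const.mul (hφ.comp hproj)).add (contDiff_const.mul
    ((contDiff_snd.snd.sub ((hA.comp hproj).const_smul (e / c))).norm_sq ℝ))

theorem momentumGradient_phaseSpaceHamiltonian (w : ℝ × Space × Space) :
    momentumGradient (phaseSpaceHamiltonian e c μ φ A) w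
      = (1 / μ) • (w.2.2 - (e / c) • A (w.1, w.2.1)) := by
  have hkinetic : HasFDerivAt (fun q : Space => hamiltonian e c μ φ A w.2.1 q w.1) _ w.2.2 :=
    ((((hasFDerivAt_id w.2.2).sub_const ((e / c) • A (w.1, w.2.1))).norm_sq.const_mul
      (1 / (2 * μ))).const_add (e * φ (w.1, w.2.1)))
  refine ext_inner_right ℝ fun v => ?_
  refine inner_gradient_left.trans ((DFunLike.congr_fun hkinetic.fderiv v).trans ?_)
  simp only [one_div, mul_inv_rev, id_eq, map_sub, map_smul, ContinuousLinearMap.comp_id,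
    smul_apply, sub_apply, coe_innerSL_apply, smul_eq_mul, nsmul_eq_mul, Nat.cast_ofNat,
    real_inner_smul_left, inner_sub_left]
  ring

theorem slab_eq_prod (T : ℝ) : slab T = Ioo (-T) T ×ˢ univ := by
  ext z
  simp [slab, abs_lt]

theorem isHamiltonFlow_of_isRay
    (hray : ∀ x₀, IsRay e c μ φ A S₀ x₀ T (fun t => x t x₀) (fun t => p t x₀)) :
    IsHamiltonFlow (phaseSpaceHamiltonian e c μ φ A) S₀ (Ioo (-T) T) (fun z => x z.1 z.2)
      (fun z => p z.1 z.2) where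
  position_zero q := (hray q).x_zero
  momentum_zero q := (hray q).p_zero
  position_eq z hz := (hray z.2).x_eq z.1 (abs_lt.2 hz)
  momentum_eq z hz := (hray z.2).p_eq z.1 (abs_lt.2 hz)

theorem velocity_eq_kineticMomentum {I : Set ℝ}
    (h : IsHamiltonFlow (phaseSpaceHamiltonian e c μ φ A) S₀ I X P) (hXQ : IsSmoothFlow I X Q)
    (hφ : ContDiff ℝ ∞ φ) (hA : ContDiff ℝ ∞ A) (hS₀ : ContDiff ℝ ∞ S₀) (hI : IsOpen I)
    (hIc : I.OrdConnected) (h0 : 0 ∈ I) (hP : ContDiffOn ℝ ∞ P (I ×ˢ univ)) (hz : z.1 ∈ I) :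
    fderiv ℝ X (spaceTimeMap Q z) (1, 0) = (1 / μ) •
      kineticMomentum e c A (phase (phaseSpaceHamiltonian e c μ φ A) S₀ X P Q) z := by
  rw [h.fderiv_position_time (z := spaceTimeMap Q z) hI hXQ.smooth hz,
    momentumGradient_phaseSpaceHamiltonian, kineticMomentum,
    h.gradient_phase hXQ (contDiff_phaseSpaceHamiltonian hφ hA) hS₀ hI hIc h0 hP hz,
    phasePoint, hXQ.apply_label z hz]
  rfl

theorem exists_norm_schrodinger_debyeSum_le {U K : Set SpaceTime} {S : SpaceTime → ℝ}
    {a : ℕ → SpaceTime → ℂ} (hU : IsOpen U) (hA : ContDiffOn ℝ ∞ A U) (hS : ContDiffOn ℝ ∞ S U)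
    (ha : ∀ k, ContDiffOn ℝ ∞ (a k) U)
    (hHJ : ∀ z ∈ U, -deriv (fun s => S (s, z.2)) z.1
      = hamiltonian e c μ φ A z.2 (∇ (fun y => S (z.1, y)) z.2) z.1)
    (hzero : ∀ z ∈ U, transport e c μ A S (a 0) z = 0)
    (hsucc : ∀ k, ∀ z ∈ U, transport e c μ A S (a (k + 1)) z
      = Complex.I * ((1 / (2 * μ) : ℝ) : ℂ) * spaceLaplacian (a k) z)
    (N : ℕ) (hK : IsCompact K) (hKU : K ⊆ U) :
    ∃ C : ℝ, ∀ h : ℝ, 0 < h → ∀ z ∈ K,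
      ‖schrodinger e c μ h φ A (debyeSum S a h N) z‖ ≤ C * h ^ (N + 2) := by
  have hΔ : ContinuousOn (spaceLaplacian (a N)) K := fun z hz =>
    (contDiffAt_spaceLaplacian ((ha N).contDiffAt
      (hU.mem_nhds (hKU hz)))).continuousAt.continuousWithinAt
  obtain ⟨C, hC⟩ := hK.exists_bound_of_continuousOn hΔ
  refine ⟨|1 / (2 * μ)| * C, fun h hh z hz => ?_⟩
  have hzU := hU.mem_nhds (hKU hz)
  rw [schrodinger_debyeSum hh.ne' ((hA.contDiffAt hzU).of_le (WithTop.coe_le_coe.2 le_top))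
    ((hS.contDiffAt hzU).of_le (WithTop.coe_le_coe.2 le_top))
    (fun k => ((ha k).contDiffAt hzU).of_le (WithTop.coe_le_coe.2 le_top)) (hHJ z (hKU hz))
    (hzero z (hKU hz)) (fun k => hsucc k z (hKU hz)) N]
  calc ‖((1 / (2 * μ) : ℝ) : ℂ) * h ^ (N + 2) * spaceLaplacian (a N) z * wave S h z‖
      = |1 / (2 * μ)| * h ^ (N + 2) * ‖spaceLaplacian (a N) z‖ := by
        rw [norm_mul, norm_wave, mul_one, norm_mul, norm_mul, norm_pow, Complex.norm_real,
          Complex.norm_real, Real.norm_of_nonneg hh.le, Real.norm_eq_abs]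
    _ ≤ |1 / (2 * μ)| * h ^ (N + 2) * C := by gcongr; exact hC z hz
    _ = |1 / (2 * μ)| * C * h ^ (N + 2) := mul_right_comm _ _ _

theorem isDebyeExpansion_amplitude {S : SpaceTime → ℝ} (hXQ : IsSmoothFlow (Ioo (-T) T) X Q)
    (hT : 0 < T) (hQ : ∀ y, Q (0, y) = y) (hA : ContDiff ℝ ∞ A) (ha₀ : ContDiff ℝ ∞ a₀)
    (hS : ContDiffOn ℝ ∞ S (Ioo (-T) T ×ˢ univ)) (hS₀ : ∀ y, S (0, y) = S₀ y)
    (hHJ : ∀ z : SpaceTime, z.1 ∈ Ioo (-T) T → -deriv (fun s => S (s, z.2)) z.1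
      = hamiltonian e c μ φ A z.2 (∇ (fun y => S (z.1, y)) z.2) z.1)
    (hX : ∀ z : SpaceTime, z.1 ∈ Ioo (-T) T →
      fderiv ℝ X (spaceTimeMap Q z) (1, 0) = (1 / μ) • kineticMomentum e c A S z) :
    IsDebyeExpansion e c μ φ A S₀ a₀ T S (amplitude X Q (amplitudeDecay e c μ A S)
      (Complex.I * ((1 / (2 * μ) : ℝ) : ℂ)) a₀) := by
  have h0 : (0 : ℝ) ∈ Ioo (-T) T := ⟨neg_lt_zero.2 hT, hT⟩
  have hd : ContDiffOn ℝ ∞ (amplitudeDecay e c μ A S) (Ioo (-T) T ×ˢ univ) := fun z hz =>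
    (contDiffAt_amplitudeDecay hA.contDiffAt
      (contDiffAt_of_contDiffOn_prod_univ isOpen_Ioo hS hz.1)).contDiffWithinAt
  have ha := contDiffOn_amplitude (m := Complex.I * ((1 / (2 * μ) : ℝ) : ℂ)) hXQ isOpen_Ioo
    ordConnected_Ioo h0 hd ha₀
  refine ⟨slab_eq_prod T ▸ hS, fun k => slab_eq_prod T ▸ ha k, fun z hz => hHJ z (abs_lt.1 hz),
    hS₀, transportSolution_zero hQ _ _ _ _, fun k => transportSolution_zero hQ _ _ _ _,
    fun N K hK hKT => ?_⟩
  obtain ⟨C, hC⟩ := exists_norm_schrodinger_debyeSum_le (isOpen_Ioo.prod isOpen_univ)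
    hA.contDiffOn hS ha (fun z hz => hHJ z hz.1)
    (fun z hz => by
      rw [transport, ← hX z hz.1,
        fderiv_amplitude_zero hXQ isOpen_Ioo ordConnected_Ioo h0 hd ha₀ hz.1])
    (fun k z hz => by
      rw [transport, ← hX z hz.1,
        fderiv_amplitude_succ hXQ isOpen_Ioo ordConnected_Ioo h0 hd ha₀ k hz.1])
    N hK (slab_eq_prod T ▸ hKT)
  exact ⟨C, fun h hh _ => hC h hh⟩

end MaxwellField

end WKB

end

theorem mainTheorem12
    (e c μ : ℝ) (hc : 0 < c) (hμ : 0 < μ)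
    (φ : WKB.SpaceTime → ℝ) (hφ : ContDiff ℝ ∞ φ)
    (A : WKB.SpaceTime → WKB.Space) (hA : ContDiff ℝ ∞ A)
    (S₀ : WKB.Space → ℝ) (hS₀ : ContDiff ℝ ∞ S₀)
    (a₀ : WKB.Space → ℂ) (ha₀ : ContDiff ℝ ∞ a₀)
    (T : ℝ) (hT : 0 < T)
    (x p : ℝ → WKB.Space → WKB.Space)
    (hray : ∀ x₀ : WKB.Space,
      WKB.IsRay e c μ φ A S₀ x₀ T (fun t => x t x₀) (fun t => p t x₀))
    (hdiffeo : ∀ t : ℝ, |t| < T →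
      ∃ Φ : Diffeomorph 𝓘(ℝ, WKB.Space) 𝓘(ℝ, WKB.Space) WKB.Space WKB.Space ∞,
        ∀ x₀ : WKB.Space, Φ x₀ = x t x₀) :
    ∃ (S : WKB.SpaceTime → ℝ) (a : ℕ → WKB.SpaceTime → ℂ),
      WKB.IsDebyeExpansion e c μ φ A S₀ a₀ T S a ∧
      ∀ (k : ℕ) (t : ℝ) (y : WKB.Space), |t| < T →
        (t, y) ∉ WKB.rayTube e c μ φ A S₀ a₀ → a k (t, y) = 0 := by
  open WKB in
  have h0 : (0 : ℝ) ∈ Ioo (-T) T := ⟨neg_lt_zero.2 hT, hT⟩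
  have hH := contDiff_phaseSpaceHamiltonian (e := e) (c := c) (μ := μ) hφ hA
  have hflow := isHamiltonFlow_of_isRay hray
  have hXP := hflow.contDiffOn_phasePoint hH hS₀ isOpen_Ioo ordConnected_Ioo h0
  have hP := hXP.snd.snd
  obtain ⟨Q, hXQ⟩ := exists_isSmoothFlow isOpen_Ioo hXP.snd.fst
    fun t ht => hdiffeo t (abs_lt.2 ht)
  let S := phase (phaseSpaceHamiltonian e c μ φ A) S₀ (fun z => x z.1 z.2) (fun z => p z.1 z.2) Q
  have hS : ContDiffOn ℝ ∞ S _ := contDiffOn_phase hXQ hH hS₀ isOpen_Ioo ordConnected_Ioo h0 hP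
  refine ⟨S, _, isDebyeExpansion_amplitude hXQ hT (hflow.label_zero hXQ h0) hA ha₀ hS
    (hflow.phase_zero hXQ h0)
    (fun z => hflow.hamiltonJacobi_phase hXQ hH hS₀ isOpen_Ioo ordConnected_Ioo h0 hP)
    (fun z => velocity_eq_kineticMomentum hflow hXQ hφ hA hS₀ isOpen_Ioo ordConnected_Ioo h0 hP),
    fun k t y ht hty => ?_⟩
  have hQ : Q (t, y) ∉ tsupport a₀ := fun hmem =>
    hty ⟨Q (t, y), hmem, T, _, _, hray _, ht, hXQ.apply_label (t, y) (abs_lt.1 ht)⟩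
  exact amplitude_eq_zero hXQ isOpen_Ioo ordConnected_Ioo h0 (abs_lt.1 ht) hQ k
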